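/- Let $0<q<1$ be real and let $m\ge 0$ be an integer. Put $\square(q)=\sum_{n=-\infty}^{\infty}q^{n^2}$. For $\varepsilon\in\{0,1\}$ let $\mu_\varepsilon$ be the linear functional on real polynomials in one variable given by the Abel mean $$\mu_\varepsilon(f)=\int f\,d\mu_\varepsilon=2\lim_{t\to1^-}\sum_{k=1}^\infty t^k(-1)^{k+1+\varepsilon}k^{1+2\varepsilon}f(-k^2),$$ let $p_0^{(\varepsilon)},p_1^{(\varepsilon)},\dots$ be its monic orthogonal polynomials, where $p_n^{(\varepsilon)}$ has degree $n$, and let $\|p_n^{(\varepsilon)}\|^2=\mu_\varepsilon\big((p_n^{(\varepsilon)})^2\big)$. With $\Delta(x_1,\dots,x_n)=\prod_{1\le i<j\le n}(x_j-x_i)$, define for $0\le s\le m$ the correlation functions $$C_s^{m,\varepsilon}(x_1,\dots,x_s)=\frac{1}{(m-s)!\,\prod_{i=1}^m\|p_{i-1}^{(\varepsilon)}\|^2\,\Delta(x_1,\dots,x_s)^2}\int\Delta(x_1,\dots,x_m)^2\,d\mu_\varepsilon(x_{s+1})\cdots d\mu_\varepsilon(x_m).$$ Then $$\square(q)^{4m^2}=\sum_{s=0}^m4^s\sum_{k_1>\dots>k_s\ge1}\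 \prod_{i=1}^s\frac{q^{k_i}k_i}{1+(-q)^{k_i}}\prod_{1\le i<j\le s}(k_i^2-k_j^2)^2\;C_s^{m,0}(-k_1^2,\dots,-k_s^2),$$ $$\square(q)^{4m(m+1)}=\sum_{s=0}^m4^s\sum_{k_1>\dots>k_s\ge1}\ \prod_{i=1}^s\frac{q^{k_i}k_i^3}{1-(-q)^{k_i}}\prod_{1\le i<j\le s}(k_i^2-k_j^2)^2\;C_s^{m,1}(-k_1^2,\dots,-k_s^2),$$ where the inner sums run over strictly decreasing $s$-tuples of positive integers (one empty tuple if $s=0$) and converge absolutely. -/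

import Mathlib

open Filter Topology

noncomputable section

/-- The theta series `□(q) = ∑_{n ∈ ℤ} q^{n²}`. -/
def squareSeries (q : ℝ) : ℝ := ∑' n : ℤ, q ^ (n ^ 2)

/-- The Abel mean `lim_{t → 1⁻} ∑_{k ≥ 1} t^k c_k` of a possibly divergent series. -/
def abelSum (c : ℕ → ℝ) : ℝ :=
  limUnder (𝓝[<] (1 : ℝ)) fun t : ℝ => ∑' k : ℕ, t ^ (k + 1) * c (k + 1)

/-- The moment functional `μ_ε(f) = 2 ∑'_{k ≥ 1} (-1)^{k+1+ε} k^{1+2ε} f(-k²)`, where `∑'` is the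
Abel mean. It is meant to be applied to polynomial functions `f`, for which the limit exists. -/
def momentFunctional (ε : ℕ) (f : ℝ → ℝ) : ℝ :=
  2 * abelSum fun k => (-1) ^ (k + 1 + ε) * (k : ℝ) ^ (1 + 2 * ε) * f (-(k : ℝ) ^ 2)

/-- The monic orthogonal polynomials `p_0, p_1, …` of a positive moment functional `μ`, obtained
from `1, X, X², …` by the Gram-Schmidt process (without normalization). -/
def monicOrtho (μ : (ℝ → ℝ) → ℝ) (n : ℕ) : Polynomial ℝ :=
  Polynomial.X ^ n - ∑ k : Fin n,
    Polynomial.C (μ (fun x => x ^ n * (monicOrtho μ k).eval x) /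
      μ (fun x => (monicOrtho μ k).eval x ^ 2)) * monicOrtho μ k
termination_by n
decreasing_by all_goals exact k.isLt

/-- `‖p_n‖² = μ(p_n²)`. -/
def orthoNormSq (μ : (ℝ → ℝ) → ℝ) (n : ℕ) : ℝ :=
  μ fun x => (monicOrtho μ n).eval x ^ 2

/-- The Vandermonde product `Δ(x) = ∏_{i < j} (x_j - x_i)`. -/
def vandermondeProd {n : ℕ} (x : Fin n → ℝ) : ℝ :=
  ∏ i : Fin n, ∏ j ∈ Finset.Ioi i, (x j - x i)

/-- The iterated integral `∫ F(y_1, …, y_r) dμ(y_1) ⋯ dμ(y_r)`. -/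
def iterIntegral (μ : (ℝ → ℝ) → ℝ) : (r : ℕ) → ((Fin r → ℝ) → ℝ) → ℝ
  | 0, F => F Fin.elim0
  | r + 1, F => μ fun y => iterIntegral μ r fun z => F (Fin.cons y z)

/-- The normalized correlation function `C_s^n(x_1, …, x_s)` of the orthogonal polynomial ensemble
of `μ`, for `s ≤ n`, at a point with pairwise distinct coordinates:
`(∫ Δ(x_1, …, x_n)² dμ(x_{s+1}) ⋯ dμ(x_n)) / ((n-s)! ∏_{i=1}^n ‖p_{i-1}‖² Δ(x_1, …, x_s)²)`. -/
def correlation (μ : (ℝ → ℝ) → ℝ) (n s : ℕ) (x : Fin s → ℝ) : ℝ :=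
  1 / ((Nat.factorial (n - s) : ℝ) * (∏ i ∈ Finset.range n, orthoNormSq μ i) *
      vandermondeProd x ^ 2) *
    iterIntegral μ (n - s) fun y => vandermondeProd (Fin.append x y) ^ 2

/-- The `s`-tuples of integers `k_1 > k_2 > ⋯ > k_s ≥ 1`; there is exactly one if `s = 0`. -/
abbrev DecTuple (s : ℕ) : Type := {k : Fin s → ℕ // StrictAnti k ∧ ∀ i, 1 ≤ k i}

end

/-! Put p = -q and L(z) = ∑ (-1)^k e^{kz} / (1 + p^k), summed over all integers k, for log q < z <
0. Partial fractions turn the coefficients of L² and L³ into telescoping sums, and this yields L'' =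
2L³ - 2CL for some constant C. Hence T = -2L satisfies T'' = βT + T³/2 with T(0-) = 0 and T'(0-) =
a. The function tanh(z/2) = 2σ(z) - 1, with σ the sigmoid, solves an equation of the same shape with
a = 1/2 and β = -1/2.

For any such T, the operator -(d/dz)² acts tridiagonally on the powers T^{2n+1+ε}, up to an additive
constant when ε = 1. The derivatives of T (ε = 0) or T² (ε = 1) at 0- are therefore, up to sign and
normalization, the moments of a functional whose orthogonal polynomials obey an explicit three-term
recurrence (`IsOdeSolution.odeFunctional_X_pow`). The squared norms are a^{1+ε+2n} times a number
depending only on n and ε, so the m × m Hankel determinant is a^{m(m+ε)} times a constant free of a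
and β (`det_hankelMatrix_odeFunctional_div`).

For tanh(z/2) the functional is `momentFunctional ε`: Abel summation evaluates derivatives of σ at 0
(`momentFunctional_eq_odeFunctional`). For the Lambert series it is the same functional plus 4 times
the discrete measure with the weights of the theorem at the points -k² (`hasSum_weight_zero`,
`hasSum_weight_one`). Expanding the Hankel determinant of the sum in powers of the discrete part
produces the correlation functions (`correlation_expansion`), so the right-hand sides equal
(2a)^{m(m+ε)}.

It remains to see that 2a = □(q)⁴, which is Jacobi's four square theorem (`lambert_deriv_eq`). It
follows from writing L as a quotient of theta series, comparing derivatives at the origin, and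
evaluating the theta constants by doubling the nome. -/

open Polynomial

/-! ### Orthogonal polynomials of a linear functional -/

/-- A sequence of polynomials in which the `n`-th one is monic of degree `n`. -/
structure IsMonicSeq (P : ℕ → ℝ[X]) : Prop where
  monic : ∀ n, (P n).Monic
  natDegree : ∀ n, (P n).natDegree = n

theorem IsMonicSeq.exists_sum {P : ℕ → ℝ[X]} (hP : IsMonicSeq P) (n : ℕ) (Q : ℝ[X])
    (hQ : Q.degree < n) : ∃ c : ℕ → ℝ, Q = ∑ k ∈ Finset.range n, C (c k) * P k := by
  induction n generalizing Q with
  | zero =>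
    refine ⟨0, ?_⟩
    simp only [Nat.cast_zero, Nat.WithBot.lt_zero_iff, degree_eq_bot] at hQ
    simp [hQ]
  | succ n ih =>
    obtain ⟨c, hc⟩ := ih (Q - C (Q.coeff n) * P n) (by
      rw [Polynomial.degree_lt_iff_coeff_zero]
      intro k hk
      rw [coeff_sub, coeff_C_mul]
      rcases hk.eq_or_lt with rfl | hk
      · have := (hP.monic n).coeff_natDegree
        rw [hP.natDegree] at this
        rw [this]; ring
      · rw [(Polynomial.degree_lt_iff_coeff_zero _ _).1 hQ k hk,
          coeff_eq_zero_of_natDegree_lt (p := P n) (by rw [hP.natDegree]; exact hk)]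
        ring)
    refine ⟨Function.update c n (Q.coeff n), ?_⟩
    rw [Finset.sum_range_succ, Function.update_self]
    have : ∑ k ∈ Finset.range n, C (Function.update c n (Q.coeff n) k) * P k =
        ∑ k ∈ Finset.range n, C (c k) * P k := by
      refine Finset.sum_congr rfl fun k hk => ?_
      rw [Function.update_of_ne (Finset.mem_range.1 hk).ne]
    rw [this, ← hc]; ring

/-- Uniqueness of monic orthogonal polynomials: X^n - P n is a combination of the lower P k, and
pairing with P k shows that its coefficients are the Gram-Schmidt ones. The functional μ acts on
arbitrary functions and is known only on polynomial ones, where it agrees with the linear map l. -/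
theorem monicOrtho_eq {μ : (ℝ → ℝ) → ℝ} {l : ℝ[X] →ₗ[ℝ] ℝ}
    (hμ : ∀ Q : ℝ[X], μ (fun x => Q.eval x) = l Q) {P : ℕ → ℝ[X]} (hP : IsMonicSeq P)
    (horth : ∀ i j, i ≠ j → l (P i * P j) = 0) (hne : ∀ i, l (P i ^ 2) ≠ 0) (n : ℕ) :
    monicOrtho μ n = P n := by
  induction n using Nat.strong_induction_on with
  | _ n ih =>
    rw [monicOrtho]
    obtain ⟨c, hc⟩ := hP.exists_sum n (X ^ n - P n) (by
      rw [Polynomial.degree_lt_iff_coeff_zero]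
      intro k hk
      rw [coeff_sub, coeff_X_pow]
      rcases hk.eq_or_lt with rfl | hk
      · have := (hP.monic n).coeff_natDegree
        rw [hP.natDegree] at this
        rw [this]; simp
      · rw [coeff_eq_zero_of_natDegree_lt (by rw [hP.natDegree]; exact hk)]
        simp [hk.ne'])
    have key : ∀ k : Fin n, l (X ^ n * P k) = c k * l (P k ^ 2) := by
      intro k
      have h1 : X ^ n * P k = P n * P k + ∑ i ∈ Finset.range n, (C (c i) * P i) * P k := by
        rw [← Finset.sum_mul, ← hc]; ring
      rw [h1, map_add, horth n k k.2.ne', map_sum, zero_add,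
        Finset.sum_eq_single (k : ℕ)]
      · rw [← smul_eq_C_mul, smul_mul_assoc, map_smul, sq, smul_eq_mul]
      · intro i _ hi
        rw [← smul_eq_C_mul, smul_mul_assoc, map_smul, horth i k hi, smul_zero]
      · intro h; exact absurd (Finset.mem_range.2 k.2) h
    have hsum : ∑ k : Fin n, C (μ (fun x => x ^ n * (monicOrtho μ k).eval x) /
        μ (fun x => (monicOrtho μ k).eval x ^ 2)) * monicOrtho μ k =
        ∑ k ∈ Finset.range n, C (c k) * P k := by
      rw [← Fin.sum_univ_eq_sum_range (fun k => C (c k) * P k)]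
      refine Finset.sum_congr rfl fun k _ => ?_
      rw [ih k k.2]
      have h1 : μ (fun x => x ^ n * (P k).eval x) = l (X ^ n * P k) := by
        rw [← hμ]; simp
      have h2 : μ (fun x => (P k).eval x ^ 2) = l (P k ^ 2) := by
        rw [← hμ]; simp
      rw [h1, h2, key, mul_div_cancel_right₀ _ (hne k)]
    rw [hsum, ← hc]; ring

theorem orthoNormSq_eq {μ : (ℝ → ℝ) → ℝ} {l : ℝ[X] →ₗ[ℝ] ℝ}
    (hμ : ∀ Q : ℝ[X], μ (fun x => Q.eval x) = l Q) {P : ℕ → ℝ[X]} (hP : IsMonicSeq P)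
    (horth : ∀ i j, i ≠ j → l (P i * P j) = 0) (hne : ∀ i, l (P i ^ 2) ≠ 0) (n : ℕ) :
    orthoNormSq μ n = l (P n ^ 2) := by
  rw [orthoNormSq, monicOrtho_eq hμ hP horth hne, ← hμ]; simp

/-- The Hankel matrix of the moments of a linear functional. -/
noncomputable def hankelMatrix (l : ℝ[X] →ₗ[ℝ] ℝ) (m : ℕ) : Matrix (Fin m) (Fin m) ℝ :=
  Matrix.of fun i j => l (X ^ (i + j : ℕ))

/-- The change of basis from monomials to the P i is unitriangular, and it transforms the Hankel
form into a diagonal one by congruence. -/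
theorem det_hankelMatrix {l : ℝ[X] →ₗ[ℝ] ℝ} {P : ℕ → ℝ[X]} (hP : IsMonicSeq P)
    (horth : ∀ i j, i ≠ j → l (P i * P j) = 0) (m : ℕ) :
    (hankelMatrix l m).det = ∏ i ∈ Finset.range m, l (P i ^ 2) := by
  set A : Matrix (Fin m) (Fin m) ℝ := Matrix.of fun i j : Fin m => (P j).coeff i with hA
  have hdet : A.det = 1 := Matrix.det_matrixOfPolynomials (fun i : Fin m => P i)
    (fun i => hP.natDegree i) (fun i => hP.monic i)
  have hexp : ∀ i : Fin m, P i = ∑ k : Fin m, (A k i) • (X : ℝ[X]) ^ (k : ℕ) := by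
    intro i
    have := Fin.sum_univ_eq_sum_range (fun k => ((P i).coeff k) • (X : ℝ[X]) ^ k) m
    refine Eq.trans ?_ this.symm
    conv_lhs => rw [(P i).as_sum_range' m (by rw [hP.natDegree]; exact i.2)]
    refine Finset.sum_congr rfl fun k _ => ?_
    rw [smul_eq_C_mul, C_mul_X_pow_eq_monomial]
  have hprod : A.transpose * hankelMatrix l m * A = Matrix.diagonal fun i : Fin m => l (P i ^ 2) := by
    ext i j
    have h1 : l (P i * P j) = (A.transpose * hankelMatrix l m * A) i j := by
      rw [hexp i, hexp j, Finset.sum_mul_sum, map_sum, Matrix.mul_apply]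
      simp only [map_sum, Matrix.mul_apply, Finset.sum_mul]
      rw [Finset.sum_comm]
      refine Finset.sum_congr rfl fun k _ => Finset.sum_congr rfl fun k' _ => ?_
      rw [smul_mul_smul_comm, map_smul, ← pow_add, hankelMatrix, Matrix.of_apply,
        Matrix.transpose_apply, smul_eq_mul]
      ring
    rw [← h1]
    by_cases hij : i = j
    · subst hij; rw [Matrix.diagonal_apply_eq, sq]
    · rw [Matrix.diagonal_apply_ne _ hij, horth]
      exact fun h => hij (Fin.ext h)
  have := congrArg Matrix.det hprod
  rw [Matrix.det_mul, Matrix.det_mul, Matrix.det_transpose, hdet, Matrix.det_diagonal, one_mul,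
    mul_one] at this
  rw [this, Fin.prod_univ_eq_prod_range (fun i => l (P i ^ 2))]

/-! ### Tridiagonal operators -/

/-- The operator `X ^ n ↦ d n X ^ (n - 1) + b n X ^ n + r n X ^ (n + 1)`. -/
noncomputable def jacobiOp (d b r : ℕ → ℝ) : Module.End ℝ ℝ[X] :=
  Polynomial.lsum fun n => LinearMap.toSpanSingleton ℝ ℝ[X]
    (C (d n) * X ^ (n - 1) + C (b n) * X ^ n + C (r n) * X ^ (n + 1))

theorem jacobiOp_X_pow (d b r : ℕ → ℝ) (n : ℕ) : jacobiOp d b r (X ^ n) =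
    C (d n) * X ^ (n - 1) + C (b n) * X ^ n + C (r n) * X ^ (n + 1) := by
  rw [jacobiOp, lsum_apply, sum_def, ← monomial_one_right_eq_X_pow]
  rw [support_monomial n one_ne_zero, Finset.sum_singleton]
  simp [C_mul_X_pow_eq_monomial]

/-- The functional `P ↦ c ⟨P(J) 1, 1⟩` for a tridiagonal operator `J`. -/
noncomputable def jacobiFunctional (d b r : ℕ → ℝ) (c : ℝ) : ℝ[X] →ₗ[ℝ] ℝ where
  toFun P := c * (aeval (jacobiOp d b r) P 1).coeff 0
  map_add' P Q := by simp [mul_add]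
  map_smul' a P := by simp; ring

theorem jacobiFunctional_apply (d b r : ℕ → ℝ) (c : ℝ) (P : ℝ[X]) :
    jacobiFunctional d b r c P = c * (aeval (jacobiOp d b r) P 1).coeff 0 := rfl

/-- The monic orthogonal polynomials defined by a three-term recurrence. -/
noncomputable def jacobiPoly (d b r : ℕ → ℝ) : ℕ → ℝ[X]
  | 0 => 1
  | 1 => X - C (b 0)
  | n + 2 => (X - C (b (n + 1))) * jacobiPoly d b r (n + 1) -
      C (d (n + 1) * r n) * jacobiPoly d b r n

theorem isMonicSeq_jacobiPoly (d b r : ℕ → ℝ) : IsMonicSeq (jacobiPoly d b r) := by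
  have key : ∀ n, ((jacobiPoly d b r n).Monic ∧ (jacobiPoly d b r n).natDegree = n) ∧
      ((jacobiPoly d b r (n + 1)).Monic ∧ (jacobiPoly d b r (n + 1)).natDegree = n + 1) := by
    intro n
    induction n with
    | zero =>
      simp only [jacobiPoly]
      exact ⟨⟨monic_one, natDegree_one⟩, monic_X_sub_C _, natDegree_X_sub_C _⟩
    | succ n ih =>
      refine ⟨ih.2, ?_⟩
      obtain ⟨⟨h1, h2⟩, h3, h4⟩ := ih
      have hm : ((X - C (b (n + 1))) * jacobiPoly d b r (n + 1)).Monic :=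
        (monic_X_sub_C _).mul h3
      have hd : ((X - C (b (n + 1))) * jacobiPoly d b r (n + 1)).natDegree = n + 2 := by
        rw [(monic_X_sub_C _).natDegree_mul h3, natDegree_X_sub_C, h4]; ring
      have hlt : (C (d (n + 1) * r n) * jacobiPoly d b r n).degree <
          ((X - C (b (n + 1))) * jacobiPoly d b r (n + 1)).degree := by
        rw [degree_eq_natDegree hm.ne_zero, hd]
        rw [← smul_eq_C_mul]
        refine lt_of_le_of_lt (degree_smul_le _ _) ?_
        rw [degree_eq_natDegree h1.ne_zero, h2]
        exact_mod_cast (by omega : n < n + 2)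
      refine ⟨?_, ?_⟩
      · rw [jacobiPoly]; exact hm.sub_of_left hlt
      · rw [jacobiPoly, natDegree_sub_eq_left_of_natDegree_lt, hd]
        rw [hd]
        refine lt_of_le_of_lt (natDegree_C_mul_le _ _) ?_
        omega
  exact ⟨fun n => (key n).1.1, fun n => (key n).1.2⟩

/-- The recurrence is the one that strips everything but the top term from P_n(J) 1. The condition d
0 = 0 is needed because the truncated exponent 0 - 1 = 0 would otherwise add d 0 to the diagonal. -/
theorem aeval_jacobiOp_jacobiPoly {d b r : ℕ → ℝ} (hd : d 0 = 0) (n : ℕ) :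
    aeval (jacobiOp d b r) (jacobiPoly d b r n) 1 = C (∏ i ∈ Finset.range n, r i) * X ^ n := by
  have hJ0 : jacobiOp d b r 1 = C (b 0) + C (r 0) * X := by
    have := jacobiOp_X_pow d b r 0
    simpa [hd] using this
  have key : ∀ n, aeval (jacobiOp d b r) (jacobiPoly d b r n) 1 =
      C (∏ i ∈ Finset.range n, r i) * X ^ n ∧
      aeval (jacobiOp d b r) (jacobiPoly d b r (n + 1)) 1 =
      C (∏ i ∈ Finset.range (n + 1), r i) * X ^ (n + 1) := by
    intro n
    induction n with
    | zero =>
      simp [jacobiPoly, hJ0, Algebra.algebraMap_eq_smul_one, smul_eq_C_mul]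
    | succ n ih =>
      refine ⟨ih.2, ?_⟩
      rw [jacobiPoly, map_sub, map_mul, map_mul, LinearMap.sub_apply, Module.End.mul_apply,
        Module.End.mul_apply, ih.1, ih.2, map_sub, aeval_X, aeval_C, aeval_C, LinearMap.sub_apply,
        ← smul_eq_C_mul, map_smul, jacobiOp_X_pow]
      simp only [Algebra.algebraMap_eq_smul_one, LinearMap.smul_apply, Module.End.one_apply,
        smul_eq_C_mul, Nat.add_sub_cancel, Finset.prod_range_succ, C_mul]
      ring
  exact (key n).1

/-- One application of J lowers the order of vanishing at 0 by at most one, and the new lowest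
coefficient comes only from the lowering part. -/
theorem jacobiOp_lowest {d b r : ℕ → ℝ} (n : ℕ) (U V : ℝ[X]) (hU : U = X ^ (n + 1) * V) :
    ∃ V', jacobiOp d b r U = X ^ n * V' ∧ V'.coeff 0 = d (n + 1) * V.coeff 0 := by
  subst hU
  induction V using Polynomial.induction_on' with
  | add p q hp hq =>
    obtain ⟨p', hp1, hp2⟩ := hp
    obtain ⟨q', hq1, hq2⟩ := hq
    refine ⟨p' + q', ?_, ?_⟩
    · rw [mul_add, map_add, hp1, hq1, mul_add]
    · rw [coeff_add, coeff_add, hp2, hq2, mul_add]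
  | monomial k a =>
    refine ⟨C (a * d (n + 1 + k)) * X ^ k + C (a * b (n + 1 + k)) * X ^ (k + 1) +
      C (a * r (n + 1 + k)) * X ^ (k + 2), ?_, ?_⟩
    · rw [← C_mul_X_pow_eq_monomial, mul_left_comm, ← pow_add, ← smul_eq_C_mul, map_smul,
        jacobiOp_X_pow, smul_eq_C_mul]
      have : n + 1 + k - 1 = n + k := by omega
      rw [this]
      simp only [C_mul]
      ring
    · rcases k with _ | k
      · simp [coeff_X_pow]; ring
      · simp [coeff_X_pow, coeff_monomial]

theorem jacobiOp_pow_lowest {d b r : ℕ → ℝ} (n k : ℕ) :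
    ∃ V, (jacobiOp d b r ^ k) (X ^ (n + k)) = X ^ n * V ∧
      V.coeff 0 = ∏ i ∈ Finset.range k, d (n + i + 1) := by
  induction k generalizing n with
  | zero => exact ⟨1, by simp, by simp⟩
  | succ k ih =>
    obtain ⟨V, h1, h2⟩ := ih (n + 1)
    obtain ⟨V', h3, h4⟩ := jacobiOp_lowest (d := d) (b := b) (r := r) n _ V h1
    refine ⟨V', ?_, ?_⟩
    · rw [pow_succ', Module.End.mul_apply, ← h3]
      congr 3; ring
    · rw [h4, h2, Finset.prod_range_succ']
      simp only [add_zero]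
      rw [mul_comm]
      congr 1
      refine Finset.prod_congr rfl fun i _ => ?_
      congr 1; ring

/-- Reaching the constant term from X^n takes at least n lowering steps, so only the X^n term of P
contributes, along the single path through d n, …, d 1. -/
theorem coeff_zero_aeval_jacobiOp {d b r : ℕ → ℝ} (n : ℕ) (P : ℝ[X]) (hP : P.natDegree ≤ n) :
    (aeval (jacobiOp d b r) P (X ^ n)).coeff 0 =
      P.coeff n * ∏ i ∈ Finset.range n, d (i + 1) := by
  rw [aeval_eq_sum_range' (Nat.lt_succ_of_le hP), LinearMap.sum_apply, finsetSum_coeff,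
    Finset.sum_range_succ, Finset.sum_eq_zero, zero_add]
  · obtain ⟨V, h1, h2⟩ := jacobiOp_pow_lowest (d := d) (b := b) (r := r) 0 n
    rw [zero_add, pow_zero, one_mul] at h1
    rw [LinearMap.smul_apply, h1, coeff_smul, h2, smul_eq_mul]
    simp
  · intro k hk
    obtain ⟨V, h1, h2⟩ := jacobiOp_pow_lowest (d := d) (b := b) (r := r) (n - k) k
    have hk := Finset.mem_range.1 hk
    rw [Nat.sub_add_cancel hk.le] at h1
    rw [LinearMap.smul_apply, h1, coeff_smul, mul_coeff_zero, coeff_X_pow,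
      if_neg (by omega), zero_mul, smul_zero]

/-- The polynomial P_n raises 1 to a multiple of X^n, and P(J) must bring it back down.
Orthogonality and the norms are both special cases. -/
theorem jacobiFunctional_mul {d b r : ℕ → ℝ} {c : ℝ} (hd : d 0 = 0) (n : ℕ) (P : ℝ[X])
    (hP : P.natDegree ≤ n) : jacobiFunctional d b r c (P * jacobiPoly d b r n) =
      P.coeff n * (c * ∏ i ∈ Finset.range n, (d (i + 1) * r i)) := by
  rw [jacobiFunctional_apply, map_mul, Module.End.mul_apply, aeval_jacobiOp_jacobiPoly hd,
    ← smul_eq_C_mul, map_smul, coeff_smul, coeff_zero_aeval_jacobiOp n P hP, smul_eq_mul,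
    Finset.prod_mul_distrib]
  ring

theorem jacobiFunctional_orthogonal {d b r : ℕ → ℝ} {c : ℝ} (hd : d 0 = 0) (i j : ℕ) (h : i ≠ j) :
    jacobiFunctional d b r c (jacobiPoly d b r i * jacobiPoly d b r j) = 0 := by
  have hP := isMonicSeq_jacobiPoly d b r
  wlog hij : i < j generalizing i j
  · rw [mul_comm]; exact this j i h.symm (by omega)
  rw [jacobiFunctional_mul hd j _ (by rw [hP.natDegree]; exact hij.le),
    coeff_eq_zero_of_natDegree_lt (by rw [hP.natDegree]; exact hij), zero_mul]

theorem jacobiFunctional_sq {d b r : ℕ → ℝ} {c : ℝ} (hd : d 0 = 0) (n : ℕ) :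
    jacobiFunctional d b r c (jacobiPoly d b r n ^ 2) =
      c * ∏ i ∈ Finset.range n, (d (i + 1) * r i) := by
  have hP := isMonicSeq_jacobiPoly d b r
  have := (hP.monic n).coeff_natDegree
  rw [hP.natDegree] at this
  rw [sq, jacobiFunctional_mul hd n _ (hP.natDegree n).le, this, one_mul]

/-! ### Iterated integrals of squared Vandermonde products -/

/-- Since μ is controlled only on polynomial functions, the induction has to exhibit each inner
integral as a polynomial in the remaining variable before the outer μ is applied. -/
theorem iterIntegral_sum_prod {μ : (ℝ → ℝ) → ℝ} {l : ℝ[X] →ₗ[ℝ] ℝ}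
    (hμ : ∀ Q : ℝ[X], μ (fun x => Q.eval x) = l Q) {ι : Type*} (S : Finset ι) (r : ℕ)
    (c : ι → ℝ) (P : ι → Fin r → ℝ[X]) :
    iterIntegral μ r (fun y => ∑ t ∈ S, c t * ∏ j, (P t j).eval (y j)) =
      ∑ t ∈ S, c t * ∏ j, l (P t j) := by
  induction r generalizing c with
  | zero => simp [iterIntegral]
  | succ r ih =>
    rw [iterIntegral]
    have h1 : ∀ y : ℝ, (iterIntegral μ r fun z => ∑ t ∈ S, c t *
        ∏ j, (P t j).eval ((Fin.cons y z : Fin (r + 1) → ℝ) j)) =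
        (∑ t ∈ S, C (c t * ∏ j : Fin r, l (P t j.succ)) * P t 0).eval y := by
      intro y
      have h2 := ih (fun t => c t * (P t 0).eval y) (fun t j => P t j.succ)
      simp only [Fin.prod_univ_succ, Fin.cons_zero, Fin.cons_succ, ← mul_assoc]
      rw [h2, eval_finsetSum]
      refine Finset.sum_congr rfl fun t _ => ?_
      rw [eval_mul, eval_C]; ring
    simp_rw [h1]
    rw [hμ, map_sum]
    refine Finset.sum_congr rfl fun t _ => ?_
    rw [← smul_eq_C_mul, map_smul, smul_eq_mul, Fin.prod_univ_succ]; ring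

theorem vandermondeProd_eq_det {n : ℕ} (x : Fin n → ℝ) :
    vandermondeProd x = (Matrix.vandermonde x).det := by
  rw [Matrix.det_vandermonde, vandermondeProd]

theorem vandermondeProd_sq {n : ℕ} (x : Fin n → ℝ) :
    vandermondeProd x ^ 2 = ∑ p : Equiv.Perm (Fin n) × Equiv.Perm (Fin n),
      ((p.1.sign : ℤ) : ℝ) * ((p.2.sign : ℤ) : ℝ) * ∏ i, x i ^ (p.1 i + p.2 i : ℕ) := by
  rw [sq, vandermondeProd_eq_det, ← Matrix.det_transpose, Matrix.det_apply',
    Finset.sum_mul_sum, ← Finset.univ_product_univ, Finset.sum_product]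
  refine Finset.sum_congr rfl fun σ _ => Finset.sum_congr rfl fun τ _ => ?_
  simp only [Matrix.transpose_apply, Matrix.vandermonde_apply, pow_add, Finset.prod_mul_distrib]
  ring

theorem vandermondeProd_comp_perm_sq {n : ℕ} (x : Fin n → ℝ) (ρ : Equiv.Perm (Fin n)) :
    vandermondeProd (x ∘ ρ) ^ 2 = vandermondeProd x ^ 2 := by
  have h : Matrix.vandermonde (x ∘ ρ) = (Matrix.vandermonde x).submatrix ρ id := by
    ext i j; simp [Matrix.vandermonde_apply]
  rw [vandermondeProd_eq_det, vandermondeProd_eq_det, h, Matrix.det_permute, mul_pow]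
  have : (((ρ.sign : ℤ) : ℝ)) ^ 2 = 1 := by
    rcases Int.units_eq_one_or ρ.sign with h | h <;> simp [h]
  rw [this, one_mul]

/-- `∑ sgn(σ) sgn(τ) ∏_{i < s} a (σ i + τ i) ∏_{i ≥ s} b (σ i + τ i)`. -/
noncomputable def mixedHankel (a b : ℕ → ℝ) (s r : ℕ) : ℝ :=
  ∑ p : Equiv.Perm (Fin (s + r)) × Equiv.Perm (Fin (s + r)),
    ((p.1.sign : ℤ) : ℝ) * ((p.2.sign : ℤ) : ℝ) *
      ((∏ i : Fin s, a (p.1 (Fin.castAdd r i) + p.2 (Fin.castAdd r i) : ℕ)) *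
        ∏ j : Fin r, b (p.1 (Fin.natAdd s j) + p.2 (Fin.natAdd s j) : ℕ))

theorem iterIntegral_vandermondeProd {μ : (ℝ → ℝ) → ℝ} {l : ℝ[X] →ₗ[ℝ] ℝ}
    (hμ : ∀ Q : ℝ[X], μ (fun x => Q.eval x) = l Q) (s r : ℕ) (x : Fin s → ℝ) :
    iterIntegral μ r (fun y => vandermondeProd (Fin.append x y) ^ 2) =
      ∑ p : Equiv.Perm (Fin (s + r)) × Equiv.Perm (Fin (s + r)),
        ((p.1.sign : ℤ) : ℝ) * ((p.2.sign : ℤ) : ℝ) *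
        ((∏ i : Fin s, x i ^ (p.1 (Fin.castAdd r i) + p.2 (Fin.castAdd r i) : ℕ)) *
        ∏ j : Fin r, l (X ^ (p.1 (Fin.natAdd s j) + p.2 (Fin.natAdd s j) : ℕ))) := by
  have h := iterIntegral_sum_prod hμ Finset.univ r
    (fun p : Equiv.Perm (Fin (s + r)) × Equiv.Perm (Fin (s + r)) =>
      ((p.1.sign : ℤ) : ℝ) * ((p.2.sign : ℤ) : ℝ) *
      (∏ i : Fin s, x i ^ (p.1 (Fin.castAdd r i) + p.2 (Fin.castAdd r i) : ℕ)))
    (fun p j => X ^ (p.1 (Fin.natAdd s j) + p.2 (Fin.natAdd s j) : ℕ))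
  simp only [eval_pow, eval_X] at h
  simp only [vandermondeProd_sq, Fin.prod_univ_add, Fin.append_left, Fin.append_right]
  simp only [mul_assoc] at h ⊢
  exact h

theorem iterIntegral_vandermondeProd_perm (μ : (ℝ → ℝ) → ℝ) (s r : ℕ) (x : Fin s → ℝ)
    (σ : Equiv.Perm (Fin s)) :
    iterIntegral μ r (fun y => vandermondeProd (Fin.append (x ∘ σ) y) ^ 2) =
      iterIntegral μ r (fun y => vandermondeProd (Fin.append x y) ^ 2) := by
  congr 1
  funext y
  have h : Fin.append (x ∘ σ) y =
      Fin.append x y ∘ (finSumFinEquiv.permCongr (Equiv.sumCongr σ (Equiv.refl (Fin r)))) := by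
    funext i
    refine Fin.addCases (fun i => ?_) (fun i => ?_) i
    · simp [Equiv.permCongr_apply]
    · simp [Equiv.permCongr_apply]
  rw [h, vandermondeProd_comp_perm_sq]

theorem iterIntegral_vandermondeProd_eq_zero {μ : (ℝ → ℝ) → ℝ} {l : ℝ[X] →ₗ[ℝ] ℝ}
    (hμ : ∀ Q : ℝ[X], μ (fun x => Q.eval x) = l Q) (s r : ℕ) (x : Fin s → ℝ)
    (hx : ¬ Function.Injective x) :
    iterIntegral μ r (fun y => vandermondeProd (Fin.append x y) ^ 2) = 0 := by
  have h : ∀ y : Fin r → ℝ, vandermondeProd (Fin.append x y) ^ 2 = 0 := by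
    intro y
    simp only [Function.Injective, not_forall] at hx
    obtain ⟨i, j, hij, hne⟩ := hx
    rw [vandermondeProd_eq_det, Matrix.det_vandermonde_eq_zero_iff.2, zero_pow two_ne_zero]
    refine ⟨Fin.castAdd r i, Fin.castAdd r j, ?_, ?_⟩
    · simpa using hij
    · simpa using hne
  simp only [h]
  -- The zero integrand is treated as an empty sum of products, because μ 0 = 0 is available only
  -- through l.
  have h2 := iterIntegral_sum_prod hμ (∅ : Finset ℕ) r (fun _ => 0) (fun _ _ => 0)
  simpa using h2

/-- For each fixed σ the sum over τ is the determinant with rows permuted by σ, whose sign cancels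
sgn σ. -/
theorem sum_perm_perm_eq_det {n : ℕ} (M : Matrix (Fin n) (Fin n) ℝ) :
    ∑ p : Equiv.Perm (Fin n) × Equiv.Perm (Fin n),
      ((p.1.sign : ℤ) : ℝ) * ((p.2.sign : ℤ) : ℝ) * ∏ i, M (p.1 i) (p.2 i) =
      (n.factorial : ℝ) * M.det := by
  rw [← Finset.univ_product_univ, Finset.sum_product]
  have h : ∀ σ : Equiv.Perm (Fin n), ∑ τ : Equiv.Perm (Fin n),
      ((σ.sign : ℤ) : ℝ) * ((τ.sign : ℤ) : ℝ) * ∏ i, M (σ i) (τ i) = M.det := by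
    intro σ
    have h1 : (M.submatrix σ id).det = ((σ.sign : ℤ) : ℝ) * M.det := Matrix.det_permute σ M
    rw [← Matrix.det_transpose, Matrix.det_apply'] at h1
    have h2 : (((σ.sign : ℤ) : ℝ)) * ((σ.sign : ℤ) : ℝ) = 1 := by
      rcases Int.units_eq_one_or σ.sign with h | h <;> simp [h]
    calc _ = ((σ.sign : ℤ) : ℝ) * ∑ τ : Equiv.Perm (Fin n), ((τ.sign : ℤ) : ℝ) *
          ∏ i, (M.submatrix σ id).transpose (τ i) i := by
            rw [Finset.mul_sum]
            refine Finset.sum_congr rfl fun τ _ => ?_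
            simp [mul_assoc]
      _ = M.det := by rw [h1, ← mul_assoc, h2, one_mul]
  simp only [h]
  simp [Fintype.card_perm]

/-- Composing both permutations with a ρ that carries the first s indices onto I multiplies each
sign by sgn ρ, and the two factors cancel. Only the size of I matters. -/
theorem sum_perm_subset_eq_mixedHankel (a b : ℕ → ℝ) (s r : ℕ) (I : Finset (Fin (s + r)))
    (hI : I.card = s) :
    ∑ p : Equiv.Perm (Fin (s + r)) × Equiv.Perm (Fin (s + r)),
      ((p.1.sign : ℤ) : ℝ) * ((p.2.sign : ℤ) : ℝ) *
      ((∏ i ∈ I, a (p.1 i + p.2 i : ℕ)) * ∏ i ∈ Finset.univ \ I, b (p.1 i + p.2 i : ℕ)) =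
    mixedHankel a b s r := by
  have hcard : Fintype.card {i : Fin (s + r) // i.val < s} = Fintype.card {i // i ∈ I} := by
    rw [Fintype.card_coe, hI, Fintype.card_subtype]
    have : (Finset.univ.filter fun i : Fin (s + r) => i.val < s) =
        Finset.univ.map (Fin.castAddEmb r : Fin s ↪ Fin (s + r)) := by
      ext i
      simp only [Finset.mem_filter, Finset.mem_univ, true_and, Finset.mem_map]
      refine ⟨fun h => ⟨⟨i, h⟩, by ext; simp⟩, ?_⟩
      rintro ⟨j, rfl⟩
      simp
    rw [this, Finset.card_map, Finset.card_univ, Fintype.card_fin]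
  set e := Fintype.equivOfCardEq hcard
  set ρ : Equiv.Perm (Fin (s + r)) := e.extendSubtype with hρ
  have h1 : ∀ i : Fin s, ρ (Fin.castAdd r i) ∈ I := fun i =>
    e.extendSubtype_mem _ (by simp)
  have h2 : ∀ j : Fin r, ρ (Fin.natAdd s j) ∉ I := fun j =>
    e.extendSubtype_not_mem _ (by simp)
  rw [mixedHankel]
  conv_rhs => rw [← Equiv.sum_comp ((Equiv.mulRight ρ).prodCongr (Equiv.mulRight ρ))]
  refine Finset.sum_congr rfl fun p _ => ?_
  have h3 : (((ρ.sign : ℤ) : ℝ)) * ((ρ.sign : ℤ) : ℝ) = 1 := by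
    rcases Int.units_eq_one_or ρ.sign with h | h <;> simp [h]
  have h4 : ∀ f g : Fin (s + r) → ℝ, (∏ i ∈ I, f i) * ∏ i ∈ Finset.univ \ I, g i =
      (∏ i : Fin s, f (ρ (Fin.castAdd r i))) * ∏ j : Fin r, g (ρ (Fin.natAdd s j)) := by
    intro f g
    have h5 : (∏ i ∈ I, f i) * ∏ i ∈ Finset.univ \ I, g i = ∏ i, if i ∈ I then f i else g i := by
      rw [Finset.prod_ite]
      congr 1
      · refine Finset.prod_congr ?_ fun _ _ => rfl
        ext; simp
      · refine Finset.prod_congr ?_ fun _ _ => rfl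
        ext; simp
    rw [h5, ← Equiv.prod_comp ρ, Fin.prod_univ_add]
    simp only [h1, h2, if_true, if_false]
  rw [h4]
  simp only [Equiv.prodCongr_apply, Prod.map_fst, Prod.map_snd, Equiv.coe_mulRight,
    Equiv.Perm.sign_mul, Units.val_mul, Int.cast_mul, Equiv.Perm.mul_apply]
  linear_combination -(((p.1.sign : ℤ) : ℝ) * ((p.2.sign : ℤ) : ℝ) *
    ((∏ i : Fin s, a (p.1 (ρ (Fin.castAdd r i)) + p.2 (ρ (Fin.castAdd r i)) : ℕ)) *
      ∏ j : Fin r, b (p.1 (ρ (Fin.natAdd s j)) + p.2 (ρ (Fin.natAdd s j)) : ℕ))) * h3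

/-- In the double sum over permutations each factor is either from a or from b. The choices are
grouped by the set I of a-indices, and the sets of size s contribute equally. -/
theorem factorial_mul_det_add (a b : ℕ → ℝ) (c : ℝ) (m : ℕ) :
    (m.factorial : ℝ) * (Matrix.of fun i j : Fin m => b (i + j) + c * a (i + j)).det =
      ∑ s ∈ Finset.range (m + 1), (m.choose s : ℝ) * (c ^ s * mixedHankel a b s (m - s)) := by
  rw [← sum_perm_perm_eq_det]
  simp only [Matrix.of_apply]
  have h1 : ∀ p : Equiv.Perm (Fin m) × Equiv.Perm (Fin m),
      ∏ i, (b (p.1 i + p.2 i : ℕ) + c * a (p.1 i + p.2 i : ℕ)) =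
      ∑ s ∈ Finset.range (m + 1), ∑ I ∈ Finset.powersetCard s Finset.univ,
        c ^ s * ((∏ i ∈ I, a (p.1 i + p.2 i : ℕ)) *
          ∏ i ∈ Finset.univ \ I, b (p.1 i + p.2 i : ℕ)) := by
    intro p
    simp_rw [add_comm (b _)]
    rw [Finset.prod_add, Finset.sum_powerset]
    simp only [Finset.card_univ, Fintype.card_fin]
    refine Finset.sum_congr rfl fun s _ => Finset.sum_congr rfl fun I hI => ?_
    rw [Finset.prod_mul_distrib, Finset.prod_const, (Finset.mem_powersetCard.1 hI).2]
    ring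
  simp only [h1, Finset.mul_sum]
  rw [Finset.sum_comm]
  refine Finset.sum_congr rfl fun s hs => ?_
  obtain ⟨r, rfl⟩ := Nat.exists_eq_add_of_le (Nat.lt_succ_iff.1 (Finset.mem_range.1 hs))
  rw [Finset.sum_comm, Nat.add_sub_cancel_left]
  have h2 : ∀ I ∈ Finset.powersetCard s (Finset.univ : Finset (Fin (s + r))),
      ∑ p : Equiv.Perm (Fin (s + r)) × Equiv.Perm (Fin (s + r)),
      ((p.1.sign : ℤ) : ℝ) * ((p.2.sign : ℤ) : ℝ) * (c ^ s *
      ((∏ i ∈ I, a (p.1 i + p.2 i : ℕ)) * ∏ i ∈ Finset.univ \ I, b (p.1 i + p.2 i : ℕ))) =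
      c ^ s * mixedHankel a b s r := by
    intro I hI
    rw [← sum_perm_subset_eq_mixedHankel a b s r I (Finset.mem_powersetCard.1 hI).2,
      Finset.mul_sum]
    exact Finset.sum_congr rfl fun p _ => by ring
  rw [Finset.sum_congr rfl h2, Finset.sum_const, Finset.card_powersetCard, Finset.card_univ,
    Fintype.card_fin, nsmul_eq_mul]

/-! ### Sums over decreasing tuples -/

theorem HasSum.congr_of_eq {ι : Type*} {f g : ι → ℝ} {a b : ℝ} (h : HasSum f a)
    (hf : ∀ i, g i = f i) (hab : b = a) : HasSum g b := by
  subst hab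
  rw [funext hf]
  exact h

theorem hasSum_prod_mul {ι κ : Type*} {f : ι → ℝ} {g : κ → ℝ} {a b : ℝ} (hf : HasSum f a)
    (hg : HasSum g b) : HasSum (fun p : ι × κ => f p.1 * g p.2) (a * b) :=
  HasSum.mul hf hg (summable_mul_of_summable_norm hf.summable.norm hg.summable.norm)

theorem hasSum_pi_prod {s : ℕ} {f : Fin s → ℕ → ℝ} {a : Fin s → ℝ}
    (hf : ∀ i, HasSum (f i) (a i)) :
    HasSum (fun k : Fin s → ℕ => ∏ i, f i (k i)) (∏ i, a i) := by
  induction s with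
  | zero =>
    simp
  | succ s ih =>
    have h1 := ih fun i => hf i.succ
    have h2 := hasSum_prod_mul (hf 0) h1
    rw [Fin.prod_univ_succ]
    refine ((Fin.consEquiv fun _ : Fin (s + 1) => ℕ).hasSum_iff).1 ?_
    refine h2.congr_of_eq (fun p => ?_) rfl
    simp [Fin.prod_univ_succ]

theorem exists_decTuple_comp {s : ℕ} (k : Fin s → ℕ) (hk : Function.Injective k)
    (hk1 : ∀ i, 1 ≤ k i) : ∃ (d : DecTuple s) (σ : Equiv.Perm (Fin s)), d.1 ∘ σ = k := by
  have h1 : StrictMono (k ∘ Tuple.sort k) :=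
    (Tuple.monotone_sort k).strictMono_of_injective (hk.comp (Tuple.sort k).injective)
  refine ⟨⟨(k ∘ Tuple.sort k) ∘ Fin.rev, fun i j hij => h1 (Fin.rev_lt_rev.2 hij),
    fun i => hk1 _⟩, Fin.revPerm.trans (Tuple.sort k) |>.symm, ?_⟩
  funext i
  simp

theorem decTuple_comp_injective (s : ℕ) : Function.Injective
    fun p : DecTuple s × Equiv.Perm (Fin s) => p.1.1 ∘ p.2 := by
  rintro ⟨d, σ⟩ ⟨d', σ'⟩ h
  simp only at h
  have hr : Set.range d.1 = Set.range d'.1 := by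
    rw [← σ.surjective.range_comp d.1, h, σ'.surjective.range_comp d'.1]
  have hd : d = d' := by
    refine Subtype.ext ?_
    have := (StrictMono.range_inj (f := d.1 ∘ Fin.rev) (g := d'.1 ∘ Fin.rev)
      (fun i j hij => d.2.1 (Fin.rev_lt_rev.2 hij))
      (fun i j hij => d'.2.1 (Fin.rev_lt_rev.2 hij))).1 (by
        rw [Fin.rev_surjective.range_comp, Fin.rev_surjective.range_comp, hr])
    funext i
    simpa using congrFun this (Fin.rev i)
  subst hd
  have hσ : σ = σ' := Equiv.ext fun i => d.2.1.injective (congrFun h i)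
  rw [hσ]

/-- The tuples on which F can be nonzero have distinct positive entries, and each of them is a
unique rearrangement of a unique decreasing tuple. This gives s! equal terms per decreasing tuple.
-/
theorem hasSum_decTuple {s : ℕ} {F : (Fin s → ℕ) → ℝ} {S : ℝ} (hF : HasSum F S)
    (hinj : ∀ k, ¬ Function.Injective k → F k = 0) (hzero : ∀ k i, k i = 0 → F k = 0)
    (hperm : ∀ k (σ : Equiv.Perm (Fin s)), F (k ∘ σ) = F k) :
    HasSum (fun d : DecTuple s => F d.1) (S / s.factorial) := by
  have h1 : HasSum (fun p : DecTuple s × Equiv.Perm (Fin s) => F (p.1.1 ∘ p.2)) S := by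
    refine ((decTuple_comp_injective s).hasSum_iff ?_).2 hF
    intro k hk
    by_contra hne
    have h1 : Function.Injective k := by
      by_contra h; exact hne (hinj k h)
    have h2 : ∀ i, 1 ≤ k i := by
      intro i
      by_contra h
      exact hne (hzero k i (by omega))
    obtain ⟨d, σ, h⟩ := exists_decTuple_comp k h1 h2
    exact hk ⟨(d, σ), h⟩
  simp only [hperm] at h1
  have h2 := h1.prod_fiberwise (g := fun d : DecTuple s => (s.factorial : ℝ) * F d.1) fun d => by
    have := hasSum_fintype (fun _ : Equiv.Perm (Fin s) => F d.1)
    simpa [Fintype.card_perm] using this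
  have h3 := h2.div_const (s.factorial : ℝ)
  refine h3.congr_of_eq (fun d => ?_) rfl
  have : (s.factorial : ℝ) ≠ 0 := by positivity
  field_simp

/-! ### The sum over correlation functions -/

/-- The squared Vandermonde factor cancels the denominator of `correlation`, leaving a symmetric
iterated integral. Summed over all tuples it factors into moments of L for the first s variables and
of l for the others. These are the terms in the expansion of the Hankel determinant of l + cL, and
the factorials recombine into the binomial coefficient. -/
theorem correlation_expansion {μ : (ℝ → ℝ) → ℝ} {l L : ℝ[X] →ₗ[ℝ] ℝ}
    (hμ : ∀ Q : ℝ[X], μ (fun x => Q.eval x) = l Q) (hne : ∀ i, orthoNormSq μ i ≠ 0)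
    {w x : ℕ → ℝ} (hw : w 0 = 0) (hx : Function.Injective x)
    (hL : ∀ j, HasSum (fun k => w k * x k ^ j) (L (X ^ j))) (c : ℝ) (m : ℕ) :
    (∀ s ≤ m, Summable fun k : DecTuple s => (∏ i, w (k.1 i)) *
      (∏ i, ∏ j ∈ Finset.Ioi i, (x (k.1 j) - x (k.1 i)) ^ 2) *
        correlation μ m s (fun i => x (k.1 i))) ∧
    ∑ s ∈ Finset.range (m + 1), c ^ s * ∑' k : DecTuple s, (∏ i, w (k.1 i)) *
      (∏ i, ∏ j ∈ Finset.Ioi i, (x (k.1 j) - x (k.1 i)) ^ 2) *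
        correlation μ m s (fun i => x (k.1 i)) =
      (hankelMatrix (l + c • L) m).det / ∏ i ∈ Finset.range m, orthoNormSq μ i := by
  set h : ℝ := ∏ i ∈ Finset.range m, orthoNormSq μ i with hh
  have hh0 : h ≠ 0 := Finset.prod_ne_zero_iff.2 fun i _ => hne i
  set a : ℕ → ℝ := fun j => L (X ^ j)
  set b : ℕ → ℝ := fun j => l (X ^ j)
  have key : ∀ s r : ℕ, HasSum (fun k : DecTuple s => (∏ i, w (k.1 i)) *
      iterIntegral μ r (fun y => vandermondeProd (Fin.append (fun i => x (k.1 i)) y) ^ 2))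
      (mixedHankel a b s r / s.factorial) := by
    intro s r
    refine hasSum_decTuple (F := fun k : Fin s → ℕ => (∏ i, w (k i)) *
      iterIntegral μ r (fun y => vandermondeProd (Fin.append (fun i => x (k i)) y) ^ 2))
      ?_ ?_ ?_ ?_
    · simp only [iterIntegral_vandermondeProd hμ, Finset.mul_sum, mixedHankel]
      refine hasSum_sum fun p _ => ?_
      have h1 := hasSum_pi_prod (f := fun (i : Fin s) k =>
        w k * x k ^ (p.1 (Fin.castAdd r i) + p.2 (Fin.castAdd r i) : ℕ)) (fun i => hL _)
      have h2 := h1.mul_left (((p.1.sign : ℤ) : ℝ) * ((p.2.sign : ℤ) : ℝ) *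
        ∏ j : Fin r, b (p.1 (Fin.natAdd s j) + p.2 (Fin.natAdd s j) : ℕ))
      refine h2.congr_of_eq (fun k => ?_) ?_
      · rw [Finset.prod_mul_distrib]
        simp only [b]
        ring
      · simp only [a, b]
        ring
    · intro k hk
      rw [iterIntegral_vandermondeProd_eq_zero hμ, mul_zero]
      exact fun hi => hk fun i j hij => hi (congrArg x hij)
    -- The one-variable sums start at k = 0 and decreasing tuples at 1; the vanishing weight w 0
    -- reconciles the two.
    · intro k i hi
      rw [Finset.prod_eq_zero (Finset.mem_univ i) (by rw [hi, hw]), zero_mul]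
    · intro k σ
      have h1 := iterIntegral_vandermondeProd_perm μ s r (fun i => x (k i)) σ
      simp only [Function.comp_def] at h1 ⊢
      rw [h1, Equiv.prod_comp σ fun i => w (k i)]
  have hterm : ∀ s, ∀ k : DecTuple s, (∏ i, w (k.1 i)) *
      (∏ i, ∏ j ∈ Finset.Ioi i, (x (k.1 j) - x (k.1 i)) ^ 2) *
        correlation μ m s (fun i => x (k.1 i)) = ((∏ i, w (k.1 i)) *
      iterIntegral μ (m - s) (fun y => vandermondeProd (Fin.append (fun i => x (k.1 i)) y) ^ 2)) *
        (1 / ((m - s).factorial * h)) := by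
    intro s k
    have h1 : (∏ i, ∏ j ∈ Finset.Ioi i, (x (k.1 j) - x (k.1 i)) ^ 2) =
        vandermondeProd (fun i => x (k.1 i)) ^ 2 := by
      simp only [vandermondeProd, Finset.prod_pow]
    have h2 : vandermondeProd (fun i => x (k.1 i)) ≠ 0 := by
      rw [vandermondeProd_eq_det, Matrix.det_vandermonde_ne_zero_iff]
      exact hx.comp k.2.1.injective
    have h3 : ((m - s).factorial : ℝ) ≠ 0 := by positivity
    rw [h1, correlation, ← hh]
    field_simp
  have hsum : ∀ s, HasSum (fun k : DecTuple s => (∏ i, w (k.1 i)) *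
      (∏ i, ∏ j ∈ Finset.Ioi i, (x (k.1 j) - x (k.1 i)) ^ 2) *
        correlation μ m s (fun i => x (k.1 i)))
      (mixedHankel a b s (m - s) / s.factorial * (1 / ((m - s).factorial * h))) := by
    intro s
    simp only [hterm]
    exact (key s (m - s)).mul_right _
  refine ⟨fun s _ => (hsum s).summable, ?_⟩
  have hdet : hankelMatrix (l + c • L) m =
      Matrix.of fun i j : Fin m => b (i + j) + c * a (i + j) := by
    ext i j
    simp [hankelMatrix, a, b]
  have hm : (m.factorial : ℝ) ≠ 0 := by positivity
  have h1 := factorial_mul_det_add a b c m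
  rw [hdet, eq_div_iff hh0, ← mul_right_inj' hm, h1, Finset.sum_mul, Finset.mul_sum]
  refine Finset.sum_congr rfl fun s hs => ?_
  have h2 := Nat.choose_mul_factorial_mul_factorial (Nat.lt_succ_iff.1 (Finset.mem_range.1 hs))
  have h3 : (m.choose s : ℝ) * s.factorial * (m - s).factorial = m.factorial := by
    exact_mod_cast h2
  have h4 : (s.factorial : ℝ) ≠ 0 := by positivity
  have h5 : ((m - s).factorial : ℝ) ≠ 0 := by positivity
  rw [(hsum s).tsum_eq, ← h3]
  field_simp

/-! ### Bilateral exponential series -/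

/-- The sum `∑_{k ∈ ℤ} c_k e^{kz}`. -/
noncomputable def expSeries (c : ℤ → ℝ) (z : ℝ) : ℝ := ∑' k : ℤ, c k * Real.exp (k * z)

/-- The series `∑ c_k e^{kz}` converges for `u < z < v`. -/
def ExpSummable (c : ℤ → ℝ) (u v : ℝ) : Prop :=
  ∀ z ∈ Set.Ioo u v, Summable fun k : ℤ => c k * Real.exp (k * z)

/-- The factor |k| is absorbed by e^{|k|δ}, at the cost of moving z to one of the two outer points
according to the sign of k. The resulting bound is uniform in z and permits termwise
differentiation. -/
theorem abs_intCast_mul_exp_le {δ z₁ z₂ z : ℝ} (hδ : 0 < δ) (h₁ : z₁ + δ ≤ z) (h₂ : z ≤ z₂ - δ)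
    (k : ℤ) : |(k : ℝ)| * Real.exp (k * z) ≤
      δ⁻¹ * (Real.exp (k * z₁) + Real.exp (k * z₂)) := by
  have h3 : |(k : ℝ)| ≤ δ⁻¹ * Real.exp (|(k : ℝ)| * δ) := by
    rw [← div_eq_inv_mul, le_div_iff₀ hδ]
    have := Real.add_one_le_exp (|(k : ℝ)| * δ)
    linarith
  have h4 : Real.exp (|(k : ℝ)| * δ) * Real.exp (k * z) ≤
      Real.exp (k * z₁) + Real.exp (k * z₂) := by
    rw [← Real.exp_add]
    rcases le_total 0 (k : ℝ) with hk | hk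
    · rw [abs_of_nonneg hk]
      have : Real.exp (k * δ + k * z) ≤ Real.exp (k * z₂) := Real.exp_le_exp.2 (by nlinarith)
      have := Real.exp_pos (k * z₁)
      linarith
    · rw [abs_of_nonpos hk]
      have : Real.exp (-k * δ + k * z) ≤ Real.exp (k * z₁) := Real.exp_le_exp.2 (by nlinarith)
      have := Real.exp_pos (k * z₂)
      linarith
  calc |(k : ℝ)| * Real.exp (k * z) ≤ δ⁻¹ * Real.exp (|(k : ℝ)| * δ) * Real.exp (k * z) :=
        mul_le_mul_of_nonneg_right h3 (Real.exp_pos _).le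
    _ = δ⁻¹ * (Real.exp (|(k : ℝ)| * δ) * Real.exp (k * z)) := by ring
    _ ≤ _ := mul_le_mul_of_nonneg_left h4 (inv_nonneg.2 hδ.le)

theorem ExpSummable.exists_bound {c : ℤ → ℝ} {u v : ℝ} (h : ExpSummable c u v) {z₀ : ℝ}
    (hz₀ : z₀ ∈ Set.Ioo u v) : ∃ δ > 0, ∃ b : ℤ → ℝ, Summable b ∧
      ∀ z ∈ Set.Ioo (z₀ - δ) (z₀ + δ), ∀ k : ℤ, ‖(k * c k) * Real.exp (k * z)‖ ≤ b k := by
  obtain ⟨hu, hv⟩ := hz₀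
  obtain ⟨z₁, hz₁, hz₁'⟩ := exists_between hu
  obtain ⟨z₂, hz₂, hz₂'⟩ := exists_between hv
  set δ := min (z₀ - z₁) (z₂ - z₀) / 2 with hδ
  have hδ0 : 0 < δ := by
    have : 0 < min (z₀ - z₁) (z₂ - z₀) := lt_min (by linarith) (by linarith)
    positivity
  have h1 : 2 * δ ≤ z₀ - z₁ := by rw [hδ]; linarith [min_le_left (z₀ - z₁) (z₂ - z₀)]
  have h2 : 2 * δ ≤ z₂ - z₀ := by rw [hδ]; linarith [min_le_right (z₀ - z₁) (z₂ - z₀)]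
  refine ⟨δ, hδ0, fun k => δ⁻¹ * (|c k * Real.exp (k * z₁)| + |c k * Real.exp (k * z₂)|), ?_, ?_⟩
  · exact ((h z₁ ⟨hz₁, hz₁'.trans hv⟩).abs.add (h z₂ ⟨hu.trans hz₂, hz₂'⟩).abs).mul_left _
  · intro z hz k
    have h3 := abs_intCast_mul_exp_le hδ0 (z₁ := z₁) (z₂ := z₂) (z := z) (by linarith [hz.1])
      (by linarith [hz.2]) k
    simp only [Real.norm_eq_abs, abs_mul, Real.abs_exp]
    calc |(k : ℝ)| * |c k| * Real.exp (k * z) = |c k| * (|(k : ℝ)| * Real.exp (k * z)) := by ring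
      _ ≤ |c k| * (δ⁻¹ * (Real.exp (k * z₁) + Real.exp (k * z₂))) :=
        mul_le_mul_of_nonneg_left h3 (abs_nonneg _)
      _ = _ := by ring

theorem ExpSummable.intCast_mul {c : ℤ → ℝ} {u v : ℝ} (h : ExpSummable c u v) :
    ExpSummable (fun k => k * c k) u v := by
  intro z hz
  obtain ⟨δ, hδ, b, hb, hle⟩ := h.exists_bound hz
  exact Summable.of_norm_bounded hb fun k => hle z ⟨by linarith, by linarith⟩ k

theorem ExpSummable.hasDerivAt {c : ℤ → ℝ} {u v : ℝ} (h : ExpSummable c u v) {z : ℝ}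
    (hz : z ∈ Set.Ioo u v) :
    HasDerivAt (expSeries c) (expSeries (fun k => k * c k) z) z := by
  obtain ⟨δ, hδ, b, hb, hle⟩ := h.exists_bound hz
  have hz' : z ∈ Set.Ioo (z - δ) (z + δ) := ⟨by linarith, by linarith⟩
  refine hasDerivAt_tsum_of_isPreconnected (g := fun (k : ℤ) z => c k * Real.exp (k * z))
    (g' := fun k z => (k * c k) * Real.exp (k * z)) hb isOpen_Ioo isPreconnected_Ioo ?_
    (fun k y hy => hle y hy k) hz' (h z hz) hz'
  intro k y _
  have h1 : HasDerivAt (fun y : ℝ => (k : ℝ) * y) k y := by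
    simpa using (hasDerivAt_id y).const_mul (k : ℝ)
  have h2 := (h1.exp).const_mul (c k)
  rwa [show (k : ℝ) * c k * Real.exp (k * y) = c k * (Real.exp (k * y) * k) by ring]

theorem ExpSummable.pow_mul {c : ℤ → ℝ} {u v : ℝ} (h : ExpSummable c u v) (n : ℕ) :
    ExpSummable (fun k => (k : ℝ) ^ n * c k) u v := by
  induction n with
  | zero => simpa using h
  | succ n ih =>
    have := ih.intCast_mul
    simpa only [pow_succ', mul_assoc] using this

theorem ExpSummable.iteratedDeriv_eq {c : ℤ → ℝ} {u v : ℝ} (h : ExpSummable c u v) (n : ℕ) {z : ℝ}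
    (hz : z ∈ Set.Ioo u v) :
    iteratedDeriv n (expSeries c) z = expSeries (fun k => (k : ℝ) ^ n * c k) z := by
  induction n generalizing z with
  | zero => simp
  | succ n ih =>
    rw [iteratedDeriv_succ]
    have h1 : iteratedDeriv n (expSeries c) =ᶠ[𝓝 z] expSeries (fun k => (k : ℝ) ^ n * c k) := by
      filter_upwards [isOpen_Ioo.mem_nhds hz] with y hy using ih hy
    rw [h1.deriv_eq, ((h.pow_mul n).hasDerivAt hz).deriv]
    simp only [pow_succ', mul_assoc]

theorem ExpSummable.continuousAt {c : ℤ → ℝ} {u v : ℝ} (h : ExpSummable c u v) {z : ℝ}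
    (hz : z ∈ Set.Ioo u v) : ContinuousAt (expSeries c) z :=
  (h.hasDerivAt hz).continuousAt

theorem ExpSummable.hasSum {c : ℤ → ℝ} {u v : ℝ} (h : ExpSummable c u v) {z : ℝ}
    (hz : z ∈ Set.Ioo u v) : HasSum (fun k : ℤ => c k * Real.exp (k * z)) (expSeries c z) :=
  (h z hz).hasSum

/-- The reindexing `(n, k) ↦ (k, n - k)`. -/
def convEquiv : ℤ × ℤ ≃ ℤ × ℤ where
  toFun p := (p.2, p.1 - p.2)
  invFun p := (p.1 + p.2, p.1)
  left_inv p := by simp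
  right_inv p := by simp

theorem hasSum_conv {f g : ℤ → ℝ} {a b : ℝ} (hf : HasSum f a) (hg : HasSum g b) :
    HasSum (fun p : ℤ × ℤ => f p.2 * g (p.1 - p.2)) (a * b) :=
  (convEquiv.hasSum_iff (f := fun p : ℤ × ℤ => f p.1 * g p.2)).2 (hasSum_prod_mul hf hg)

theorem ExpSummable.summable_conv {c d : ℤ → ℝ} {u v : ℝ} (hc : ExpSummable c u v)
    (hd : ExpSummable d u v) (huv : u < v) (n : ℤ) : Summable fun k => c k * d (n - k) := by
  obtain ⟨z, hz⟩ := exists_between huv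
  have h := (hasSum_conv (hc.hasSum hz) (hd.hasSum hz)).summable.prod_factor n
  have h2 := h.mul_right (Real.exp (-(n * z)))
  refine h2.congr fun k => ?_
  have h3 : Real.exp (k * z) * Real.exp ((n - k : ℤ) * z) * Real.exp (-(n * z)) = 1 := by
    rw [← Real.exp_add, ← Real.exp_add, ← Real.exp_zero]
    congr 1; push_cast; ring
  linear_combination (c k * d (n - k)) * h3

theorem ExpSummable.hasSum_mul {c d e : ℤ → ℝ} {u v : ℝ} (hc : ExpSummable c u v)
    (hd : ExpSummable d u v) (he : ∀ n, HasSum (fun k => c k * d (n - k)) (e n)) {z : ℝ}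
    (hz : z ∈ Set.Ioo u v) :
    HasSum (fun n : ℤ => e n * Real.exp (n * z)) (expSeries c z * expSeries d z) := by
  refine (hasSum_conv (hc.hasSum hz) (hd.hasSum hz)).prod_fiberwise fun n => ?_
  refine ((he n).mul_right (Real.exp (n * z))).congr_of_eq (fun k => ?_) rfl
  have h3 : Real.exp (k * z) * Real.exp ((n - k : ℤ) * z) = Real.exp (n * z) := by
    rw [← Real.exp_add]
    congr 1; push_cast; ring
  rw [← h3]; ring

theorem ExpSummable.mul {c d e : ℤ → ℝ} {u v : ℝ} (hc : ExpSummable c u v)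
    (hd : ExpSummable d u v) (he : ∀ n, HasSum (fun k => c k * d (n - k)) (e n)) :
    ExpSummable e u v :=
  fun _ hz => (hc.hasSum_mul hd he hz).summable

theorem ExpSummable.expSeries_mul {c d e : ℤ → ℝ} {u v : ℝ} (hc : ExpSummable c u v)
    (hd : ExpSummable d u v) (he : ∀ n, HasSum (fun k => c k * d (n - k)) (e n)) {z : ℝ}
    (hz : z ∈ Set.Ioo u v) : expSeries c z * expSeries d z = expSeries e z :=
  (hc.hasSum_mul hd he hz).tsum_eq.symm

/-! ### The Lambert series `∑ (-1)^k e^{kz} / (1 + p^k)` -/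

section Lambert

variable {p : ℝ}

theorem zpow_ne_one_of_abs_lt_one (hp0 : p ≠ 0) (hp1 : |p| < 1) {n : ℤ} (hn : n ≠ 0) :
    |p| ^ n ≠ 1 := by
  intro h
  have hpos : 0 < |p| := abs_pos.2 hp0
  exact hn ((zpow_eq_one_iff_right₀ hpos.le hp1.ne).1 h)

theorem one_add_zpow_ne_zero (hp0 : p ≠ 0) (hp1 : |p| < 1) (n : ℤ) : 1 + p ^ n ≠ 0 := by
  intro h
  by_cases hn : n = 0
  · subst hn; norm_num at h
  · refine zpow_ne_one_of_abs_lt_one hp0 hp1 hn ?_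
    rw [← abs_zpow, show p ^ n = -1 by linarith]; simp

theorem one_sub_zpow_ne_zero (hp0 : p ≠ 0) (hp1 : |p| < 1) {n : ℤ} (hn : n ≠ 0) :
    1 - p ^ n ≠ 0 := by
  intro h
  refine zpow_ne_one_of_abs_lt_one hp0 hp1 hn ?_
  rw [← abs_zpow, show p ^ n = 1 by linarith]; simp

/-- `g_k = 1 / (1 + p^k)`. -/
noncomputable def lambertCoeff (p : ℝ) (k : ℤ) : ℝ := 1 / (1 + p ^ k)

/-- The symmetric step function with values `0`, `1/2`, `1`. -/
noncomputable def stepCoeff (k : ℤ) : ℝ := if k < 0 then 0 else if k = 0 then 1 / 2 else 1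

theorem lambertCoeff_neg (hp0 : p ≠ 0) (hp1 : |p| < 1) (k : ℤ) :
    lambertCoeff p (-k) = 1 - lambertCoeff p k := by
  have h1 := one_add_zpow_ne_zero hp0 hp1 k
  have h2 : p ^ k ≠ 0 := zpow_ne_zero _ hp0
  have h3 := one_add_zpow_ne_zero hp0 hp1 (-k)
  rw [zpow_neg] at h3
  rw [lambertCoeff, lambertCoeff, zpow_neg]
  rw [eq_sub_iff_add_eq, div_add_div _ _ h3 h1, div_eq_one_iff_eq (mul_ne_zero h3 h1)]
  field_simp
  ring

theorem stepCoeff_neg (k : ℤ) : stepCoeff (-k) = 1 - stepCoeff k := by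
  unfold stepCoeff
  rcases lt_trichotomy k 0 with h | h | h
  · rw [if_neg (by omega), if_neg (by omega), if_pos h]; norm_num
  · subst h; norm_num
  · rw [if_pos (by omega), if_neg (by omega), if_neg (by omega)]; norm_num

theorem lambertCoeff_sub_stepCoeff_natCast_succ (hp0 : p ≠ 0) (hp1 : |p| < 1) (k : ℕ) :
    lambertCoeff p ((k + 1 : ℕ) : ℤ) - stepCoeff ((k + 1 : ℕ) : ℤ) =
      -(p ^ (k + 1) / (1 + p ^ (k + 1))) := by
  have h1 := one_add_zpow_ne_zero hp0 hp1 ((k + 1 : ℕ) : ℤ)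
  rw [zpow_natCast] at h1
  rw [lambertCoeff, stepCoeff, if_neg (by omega), if_neg (by omega), zpow_natCast]
  field_simp
  ring

/-- For k ≥ 1 the difference is -p^k / (1 + p^k) with |1 + p^k| ≥ 1 - |p|, and it is odd in k. This
decay in both directions makes the series of differences converge on both sides of z = 0. -/
theorem abs_lambertCoeff_sub_stepCoeff_le (hp0 : p ≠ 0) (hp1 : |p| < 1) (k : ℤ) :
    |lambertCoeff p k - stepCoeff k| ≤ (1 - |p|)⁻¹ * |p| ^ k.natAbs := by
  have hpos : 0 < 1 - |p| := by linarith
  have hnat : ∀ k : ℕ, |lambertCoeff p (k : ℤ) - stepCoeff (k : ℤ)| ≤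
      (1 - |p|)⁻¹ * |p| ^ k := by
    intro k
    rcases k with _ | k
    · simp [lambertCoeff, stepCoeff]; norm_num; linarith
    · rw [lambertCoeff_sub_stepCoeff_natCast_succ hp0 hp1, abs_neg, abs_div, abs_pow,
        div_eq_inv_mul]
      refine mul_le_mul_of_nonneg_right ?_ (by positivity)
      refine inv_anti₀ hpos ?_
      have h1 : |p| ^ (k + 1) ≤ |p| := by
        simpa using pow_le_of_le_one (abs_nonneg p) hp1.le (Nat.succ_ne_zero k)
      have h2 := neg_abs_le (p ^ (k + 1))
      rw [abs_pow] at h2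
      exact le_trans (by linarith) (le_abs_self _)
  obtain ⟨n, rfl | rfl⟩ := k.eq_nat_or_neg
  · simpa using hnat n
  · rw [lambertCoeff_neg hp0 hp1, stepCoeff_neg,
      show 1 - lambertCoeff p (n : ℤ) - (1 - stepCoeff (n : ℤ)) =
      -(lambertCoeff p (n : ℤ) - stepCoeff (n : ℤ)) by ring, abs_neg]
    simpa using hnat n

theorem expSummable_of_abs_le {c : ℤ → ℝ} {C q : ℝ} (hq0 : 0 < q)
    (hc : ∀ k, |c k| ≤ C * q ^ k.natAbs) : ExpSummable c (Real.log q) (-Real.log q) := by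
  intro z hz
  have h1 : q * Real.exp z < 1 := by
    rw [← Real.exp_log hq0, ← Real.exp_add, Real.exp_lt_one_iff]
    have := hz.2; linarith
  have h2 : q * Real.exp (-z) < 1 := by
    rw [← Real.exp_log hq0, ← Real.exp_add, Real.exp_lt_one_iff]
    have := hz.1; linarith
  refine Summable.of_nat_of_neg ?_ ?_
  · refine Summable.of_norm_bounded ((summable_geometric_of_lt_one (by positivity) h1).mul_left C)
      fun k => ?_
    rw [Real.norm_eq_abs, abs_mul, abs_of_pos (Real.exp_pos _), mul_pow, ← Real.exp_nat_mul,
      ← mul_assoc]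
    have := hc k
    rw [Int.natAbs_natCast] at this
    exact mul_le_mul_of_nonneg_right this (Real.exp_pos _).le
  · refine Summable.of_norm_bounded ((summable_geometric_of_lt_one (by positivity) h2).mul_left C)
      fun k => ?_
    rw [Real.norm_eq_abs, abs_mul, abs_of_pos (Real.exp_pos _), mul_pow, ← Real.exp_nat_mul,
      ← mul_assoc]
    have := hc (-k)
    rw [Int.natAbs_neg, Int.natAbs_natCast] at this
    have h3 : (((-(k : ℤ) : ℤ) : ℝ)) * z = k * -z := by push_cast; ring
    rw [h3]
    exact mul_le_mul_of_nonneg_right this (Real.exp_pos _).le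

theorem expSummable_stepCoeff (u : ℝ) : ExpSummable (fun k => (-1) ^ k * stepCoeff k) u 0 := by
  intro z hz
  refine Summable.of_nat_of_neg ?_ ?_
  · refine Summable.of_norm_bounded (summable_geometric_of_lt_one (Real.exp_pos z).le
      (Real.exp_lt_one_iff.2 hz.2)) fun k => ?_
    have : |stepCoeff (k : ℤ)| ≤ 1 := by
      unfold stepCoeff
      split_ifs <;> norm_num
    rw [Real.norm_eq_abs, abs_mul, abs_mul, abs_of_pos (Real.exp_pos _), ← Real.exp_nat_mul]
    simpa using mul_le_mul_of_nonneg_right this (Real.exp_pos (k * z)).le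
  · refine summable_of_ne_finset_zero (s := {0}) fun k hk => ?_
    have hk : k ≠ 0 := by simpa using hk
    have : stepCoeff (-(k : ℤ)) = 0 := by
      unfold stepCoeff
      rw [if_pos (by omega)]
    simp [this]

theorem expSummable_lambertCoeff_sub_stepCoeff (hp0 : p ≠ 0) (hp1 : |p| < 1) :
    ExpSummable (fun k => (-1) ^ k * (lambertCoeff p k - stepCoeff k))
      (Real.log |p|) (-Real.log |p|) := by
  refine expSummable_of_abs_le (abs_pos.2 hp0) (C := (1 - |p|)⁻¹) fun k => ?_
  rw [abs_mul, abs_zpow]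
  simpa using abs_lambertCoeff_sub_stepCoeff_le hp0 hp1 k

theorem log_abs_neg (hp0 : p ≠ 0) (hp1 : |p| < 1) : Real.log |p| < 0 :=
  Real.log_neg (abs_pos.2 hp0) hp1

theorem expSummable_lambertCoeff (hp0 : p ≠ 0) (hp1 : |p| < 1) :
    ExpSummable (fun k => (-1) ^ k * lambertCoeff p k) (Real.log |p|) 0 := by
  intro z hz
  have h1 := expSummable_stepCoeff _ z hz
  have h2 := expSummable_lambertCoeff_sub_stepCoeff hp0 hp1 z
    ⟨hz.1, by have := log_abs_neg hp0 hp1; linarith [hz.2]⟩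
  refine (h1.add h2).congr fun k => ?_
  ring

theorem summable_lambertCoeff_sub_stepCoeff (hp0 : p ≠ 0) (hp1 : |p| < 1) (n : ℕ) :
    Summable fun k : ℤ => (k : ℝ) ^ n * (lambertCoeff p k - stepCoeff k) := by
  have h := (expSummable_lambertCoeff_sub_stepCoeff hp0 hp1).pow_mul n 0
    ⟨log_abs_neg hp0 hp1, by linarith [log_abs_neg hp0 hp1]⟩
  refine Summable.of_norm (h.norm.congr fun k => ?_)
  simp

theorem tsum_lambertCoeff_sub_stepCoeff (hp0 : p ≠ 0) (hp1 : |p| < 1) :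
    ∑' k : ℤ, (lambertCoeff p k - stepCoeff k) = 0 := by
  have h : ∑' k : ℤ, (lambertCoeff p k - stepCoeff k) =
      -∑' k : ℤ, (lambertCoeff p k - stepCoeff k) := by
    rw [← tsum_neg]
    conv_lhs => rw [← (Equiv.neg ℤ).tsum_eq]
    refine tsum_congr fun k => ?_
    rw [Equiv.neg_apply, lambertCoeff_neg hp0 hp1, stepCoeff_neg]
    ring
  linarith

theorem hasSum_comp_sub {f : ℤ → ℝ} {a : ℝ} (h : HasSum f a) (n : ℤ) :
    HasSum (fun k => f (k - n)) a :=
  (Equiv.hasSum_iff (f := f) (Equiv.subRight n)).2 h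

/-- The coefficients tend to 1 at +∞, so the two sums cannot be separated as they stand. After
subtracting the step function the shifted sums cancel, with ∑ d = 0 used for the weighted one, and
the step function contributes only at k = 0 and k = 1. -/
theorem hasSum_lambertCoeff_diff_one (hp0 : p ≠ 0) (hp1 : |p| < 1) :
    HasSum (fun k : ℤ => lambertCoeff p k - lambertCoeff p (k - 1)) 1 ∧
    HasSum (fun k : ℤ => k * (lambertCoeff p k - lambertCoeff p (k - 1))) (1 / 2) := by
  set d : ℤ → ℝ := fun k => lambertCoeff p k - stepCoeff k with hd
  have h0 : HasSum d 0 := by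
    have := (summable_lambertCoeff_sub_stepCoeff hp0 hp1 0).hasSum
    simp only [pow_zero, one_mul, tsum_lambertCoeff_sub_stepCoeff hp0 hp1] at this
    exact this
  have h1 : HasSum (fun k : ℤ => k * d k) (∑' k : ℤ, k * d k) := by
    have := (summable_lambertCoeff_sub_stepCoeff hp0 hp1 1).hasSum
    simpa only [pow_one] using this
  have h0' : HasSum (fun k : ℤ => d (k - 1)) 0 := hasSum_comp_sub h0 1
  have h1' : HasSum (fun k : ℤ => k * d (k - 1)) (∑' k : ℤ, k * d k) := by
    have := hasSum_comp_sub (h1.add h0) 1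
    refine this.congr_of_eq (fun k => ?_) (by ring)
    push_cast; ring
  have hs : ∀ k : ℤ, k ∉ ({0, 1} : Finset ℤ) → stepCoeff k - stepCoeff (k - 1) = 0 := by
    intro k hk
    simp only [Finset.mem_insert, Finset.mem_singleton, not_or] at hk
    unfold stepCoeff
    rcases lt_or_gt_of_ne hk.1 with h | h
    · rw [if_pos h, if_pos (by omega), sub_zero]
    · rw [if_neg (by omega), if_neg (by omega), if_neg (by omega), if_neg (by omega), sub_self]
  have s0 : HasSum (fun k : ℤ => stepCoeff k - stepCoeff (k - 1)) 1 := by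
    refine (hasSum_sum_of_ne_finset_zero hs).congr_of_eq (fun _ => rfl) ?_
    simp [stepCoeff]
  have s1 : HasSum (fun k : ℤ => k * (stepCoeff k - stepCoeff (k - 1))) (1 / 2) := by
    refine (hasSum_sum_of_ne_finset_zero (s := {0, 1}) fun k hk => ?_).congr_of_eq
      (fun _ => rfl) ?_
    · rw [hs k hk, mul_zero]
    · simp [stepCoeff]; norm_num
  constructor
  · refine ((h0.sub h0').add s0).congr_of_eq (fun k => ?_) (by ring)
    simp only [hd]; ring
  · refine ((h1.sub h1').add s1).congr_of_eq (fun k => ?_) (by ring)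
    simp only [hd]; ring

theorem hasSum_lambertCoeff_diff (hp0 : p ≠ 0) (hp1 : |p| < 1) (n : ℤ) :
    HasSum (fun k : ℤ => lambertCoeff p k - lambertCoeff p (k - n)) n ∧
    HasSum (fun k : ℤ => k * (lambertCoeff p k - lambertCoeff p (k - n))) ((n : ℝ) ^ 2 / 2) := by
  obtain ⟨a0, a1⟩ := hasSum_lambertCoeff_diff_one hp0 hp1
  have b0 : ∀ n : ℤ, HasSum (fun k : ℤ => lambertCoeff p (k - n) - lambertCoeff p (k - (n + 1)))
      1 := by
    intro n
    refine (hasSum_comp_sub a0 n).congr_of_eq (fun k => ?_) rfl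
    simp only [sub_sub]
  have b1 : ∀ n : ℤ, HasSum (fun k : ℤ => k * (lambertCoeff p (k - n) -
      lambertCoeff p (k - (n + 1)))) (1 / 2 + n) := by
    intro n
    refine (hasSum_comp_sub (a1.add (a0.mul_left (n : ℝ))) n).congr_of_eq
      (fun k => ?_) (by ring)
    simp only [sub_sub]
    push_cast; ring
  induction n using Int.induction_on with
  | zero => simp
  | succ n ih =>
    refine ⟨(ih.1.add (b0 n)).congr_of_eq (fun k => by ring) (by push_cast; ring),
      (ih.2.add (b1 n)).congr_of_eq (fun k => by ring) (by push_cast; ring)⟩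
  | pred n ih =>
    have e : (-(n : ℤ) - 1 + 1) = -(n : ℤ) := by ring
    have c0 := b0 (-(n : ℤ) - 1)
    have c1 := b1 (-(n : ℤ) - 1)
    rw [e] at c0 c1
    refine ⟨(ih.1.sub c0).congr_of_eq (fun k => by ring) (by push_cast; ring),
      (ih.2.sub c1).congr_of_eq (fun k => by ring) (by push_cast; ring)⟩

/-- The function `∑_{k ∈ ℤ} (-1)^k e^{kz} / (1 + p^k)` for `log |p| < z < 0`. -/
noncomputable def lambertL (p : ℝ) : ℝ → ℝ := expSeries fun k => (-1) ^ k * lambertCoeff p k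

/-- The coefficients of the square of `lambertL`. -/
noncomputable def lambertSqCoeff (p : ℝ) (n : ℤ) : ℝ :=
  if n = 0 then ∑' k : ℤ, lambertCoeff p k * lambertCoeff p (-k) else n / (1 - p ^ n)

theorem neg_one_zpow_mul_sub (n k : ℤ) : (-1 : ℝ) ^ k * (-1) ^ (n - k) = (-1) ^ n := by
  rw [← zpow_add₀ (by norm_num)]; congr 1; ring

/-- For n ≠ 0, the partial fraction g_k g_{n-k} = (g_k - g_{k-n}) / (1 - p^n) makes the convolution
telescope to n / (1 - p^n). The constant coefficient needs no closed form. -/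
theorem hasSum_lambertCoeff_conv (hp0 : p ≠ 0) (hp1 : |p| < 1) (n : ℤ) :
    HasSum (fun k : ℤ => ((-1) ^ k * lambertCoeff p k) * ((-1) ^ (n - k) * lambertCoeff p (n - k)))
      ((-1) ^ n * lambertSqCoeff p n) := by
  by_cases hn : n = 0
  · subst hn
    have hL := expSummable_lambertCoeff hp0 hp1
    have h := (hL.summable_conv hL (log_abs_neg hp0 hp1) 0).hasSum
    refine h.congr_of_eq (fun _ => rfl) ?_
    rw [lambertSqCoeff, if_pos rfl, ← tsum_mul_left]
    refine tsum_congr fun k => ?_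
    rw [← neg_one_zpow_mul_sub 0 k, zero_sub]; ring
  · have h := ((hasSum_lambertCoeff_diff hp0 hp1 n).1.mul_left ((-1) ^ n * (1 / (1 - p ^ n))))
    refine h.congr_of_eq (fun k => ?_) ?_
    · rw [← neg_one_zpow_mul_sub n k]
      have key : lambertCoeff p k * lambertCoeff p (n - k) =
          1 / (1 - p ^ n) * (lambertCoeff p k - lambertCoeff p (k - n)) := by
        have h1 := one_add_zpow_ne_zero hp0 hp1 k
        have h2 := one_add_zpow_ne_zero hp0 hp1 (n - k)
        have h3 := one_add_zpow_ne_zero hp0 hp1 (k - n)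
        have h4 := one_sub_zpow_ne_zero hp0 hp1 hn
        have h5 : p ^ k ≠ 0 := zpow_ne_zero _ hp0
        have h6 : p ^ n ≠ 0 := zpow_ne_zero _ hp0
        rw [zpow_sub₀ hp0] at h2 h3
        simp only [lambertCoeff, zpow_sub₀ hp0]
        have h7 : p ^ k + p ^ n ≠ 0 := by
          intro h; apply h2; field_simp; linarith
        have h8 : p ^ n + p ^ k ≠ 0 := by rwa [add_comm]
        field_simp
        ring
      linear_combination ((-1) ^ k * (-1) ^ (n - k)) * key
    · rw [lambertSqCoeff, if_neg hn]; ring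

theorem expSummable_lambertSqCoeff (hp0 : p ≠ 0) (hp1 : |p| < 1) :
    ExpSummable (fun n => (-1) ^ n * lambertSqCoeff p n) (Real.log |p|) 0 :=
  (expSummable_lambertCoeff hp0 hp1).mul (expSummable_lambertCoeff hp0 hp1)
    (hasSum_lambertCoeff_conv hp0 hp1)

theorem lambertL_sq (hp0 : p ≠ 0) (hp1 : |p| < 1) {z : ℝ} (hz : z ∈ Set.Ioo (Real.log |p|) 0) :
    lambertL p z ^ 2 = expSeries (fun n => (-1) ^ n * lambertSqCoeff p n) z := by
  rw [sq]
  exact (expSummable_lambertCoeff hp0 hp1).expSeries_mul (expSummable_lambertCoeff hp0 hp1)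
    (hasSum_lambertCoeff_conv hp0 hp1) hz

/-- With h_k = 1 / (1 - p^k), the relevant partial fraction is h_k g_{n-k} = g_n (h_k - g_{k-n}).
After g_n is taken out, n enters only through ∑ k (g_k - g_{k-n}) = n²/2, and all else is collected
in C. The factor n²/2 becomes half a second derivative in the differential equation. -/
theorem exists_hasSum_lambertSqCoeff_conv (hp0 : p ≠ 0) (hp1 : |p| < 1) :
    ∃ C : ℝ, ∀ n : ℤ, HasSum (fun k : ℤ => ((-1) ^ k * lambertSqCoeff p k) *
      ((-1) ^ (n - k) * lambertCoeff p (n - k)))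
      ((-1) ^ n * ((C + (n : ℝ) ^ 2 / 2) * lambertCoeff p n)) := by
  set c0 := lambertSqCoeff p 0 with hc0
  set h : ℤ → ℝ := fun k => 1 / (1 - p ^ k) with hh
  have key : ∀ n k : ℤ, ((-1) ^ k * lambertSqCoeff p k) *
      ((-1) ^ (n - k) * lambertCoeff p (n - k)) = (-1) ^ n * lambertCoeff p n *
        ((if k = 0 then c0 else 0) + k * (h k - lambertCoeff p (k - n))) := by
    intro n k
    rw [← neg_one_zpow_mul_sub n k]
    by_cases hk : k = 0
    · subst hk; simp [hc0, mul_comm]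
    · rw [if_neg hk, lambertSqCoeff, if_neg hk]
      have h1 := one_add_zpow_ne_zero hp0 hp1 n
      have h2 := one_add_zpow_ne_zero hp0 hp1 (n - k)
      have h3 := one_add_zpow_ne_zero hp0 hp1 (k - n)
      have h4 := one_sub_zpow_ne_zero hp0 hp1 hk
      have h5 : p ^ k ≠ 0 := zpow_ne_zero _ hp0
      have h6 : p ^ n ≠ 0 := zpow_ne_zero _ hp0
      rw [zpow_sub₀ hp0] at h2 h3
      have : k / (1 - p ^ k) * lambertCoeff p (n - k) =
          lambertCoeff p n * (k * (h k - lambertCoeff p (k - n))) := by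
        simp only [hh, lambertCoeff, zpow_sub₀ hp0]
        have h7 : p ^ k + p ^ n ≠ 0 := by
          intro h; apply h2; field_simp; linarith
        have h8 : p ^ n + p ^ k ≠ 0 := by rwa [add_comm]
        field_simp
        ring
      linear_combination ((-1) ^ k * (-1) ^ (n - k)) * this
  have hite : HasSum (fun k : ℤ => if k = 0 then c0 else 0) c0 := hasSum_ite_eq 0 c0
  -- Summability is read off from the convolution at n = 0, where the common factor g_0 = 1/2 can be
  -- divided out.
  have hsum : Summable fun k : ℤ => k * (h k - lambertCoeff p k) := by
    have h1 := (expSummable_lambertSqCoeff hp0 hp1).summable_conv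
      (expSummable_lambertCoeff hp0 hp1) (log_abs_neg hp0 hp1) 0
    simp only [key, sub_zero, zpow_zero, one_mul] at h1
    have h2 : lambertCoeff p 0 ≠ 0 := by simp [lambertCoeff]
    have h3 := ((summable_mul_left_iff h2).1 h1).sub hite.summable
    refine h3.congr fun k => ?_
    ring
  refine ⟨c0 + ∑' k : ℤ, k * (h k - lambertCoeff p k), fun n => ?_⟩
  have h1 := (hite.add (hsum.hasSum.add (hasSum_lambertCoeff_diff hp0 hp1 n).2)).mul_left
    ((-1) ^ n * lambertCoeff p n)
  refine h1.congr_of_eq (fun k => ?_) (by ring)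
  rw [key]; ring

/-- The differential equation `L'' = 2 L³ - 2 C L`. -/
theorem exists_lambertL_ode (hp0 : p ≠ 0) (hp1 : |p| < 1) :
    ∃ C : ℝ, ∀ z ∈ Set.Ioo (Real.log |p|) 0,
      expSeries (fun k => (k : ℝ) ^ 2 * ((-1) ^ k * lambertCoeff p k)) z =
        2 * lambertL p z ^ 3 - 2 * C * lambertL p z := by
  obtain ⟨C, hC⟩ := exists_hasSum_lambertSqCoeff_conv hp0 hp1
  refine ⟨C, fun z hz => ?_⟩
  have hL := expSummable_lambertCoeff hp0 hp1
  have h1 : lambertL p z ^ 3 = expSeries (fun n : ℤ => (-1) ^ n * ((C + (n : ℝ) ^ 2 / 2) *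
      lambertCoeff p n)) z := by
    rw [pow_succ, lambertL_sq hp0 hp1 hz]
    exact (expSummable_lambertSqCoeff hp0 hp1).expSeries_mul hL hC hz
  have h2 : expSeries (fun n : ℤ => (-1) ^ n * ((C + (n : ℝ) ^ 2 / 2) * lambertCoeff p n)) z =
      C * lambertL p z + 1 / 2 *
        expSeries (fun k => (k : ℝ) ^ 2 * ((-1) ^ k * lambertCoeff p k)) z := by
    refine HasSum.tsum_eq ?_
    refine (((hL.hasSum hz).mul_left C).add
      (((hL.pow_mul 2).hasSum hz).mul_left (1 / 2))).congr_of_eq (fun k => ?_) rfl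
    ring
  rw [h1, h2]; ring

end Lambert

/-! ### Theta constants -/

/-- The triangular exponent `k (k - 1) / 2`. -/
def triangular (k : ℤ) : ℕ := (k * (k - 1) / 2).toNat

theorem two_mul_triangular (k : ℤ) : 2 * (triangular k : ℤ) = k * (k - 1) := by
  have h1 : 0 ≤ k * (k - 1) := by
    rcases le_or_gt k 0 with h | h
    · nlinarith
    · nlinarith
  have h2 : 2 ∣ k * (k - 1) := (Int.even_mul_pred_self k).two_dvd
  rw [triangular, Int.toNat_of_nonneg (by positivity)]
  exact Int.mul_ediv_cancel' h2

theorem triangular_one_sub (k : ℤ) : triangular (1 - k) = triangular k := by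
  zify
  have h1 := two_mul_triangular k
  have h2 := two_mul_triangular (1 - k)
  linarith

theorem triangular_add_sub (r s : ℤ) :
    triangular (r + s) + triangular (r - s) = 2 * triangular r + s.natAbs ^ 2 := by
  zify
  rw [sq_abs]
  have h1 := two_mul_triangular (r + s)
  have h2 := two_mul_triangular (r - s)
  have h3 := two_mul_triangular r
  linarith

theorem triangular_add_one (p : ℝ) (hp0 : p ≠ 0) (k : ℤ) :
    p ^ triangular (k + 1) = p ^ k * p ^ triangular k := by
  rw [← zpow_natCast, ← zpow_natCast, ← zpow_add₀ hp0]
  congr 1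
  have h1 := two_mul_triangular (k + 1)
  have h2 := two_mul_triangular k
  linarith

theorem triangular_ge (M : ℕ) (k : ℤ) : M * k.natAbs ≤ triangular k + (M + 1) ^ 2 := by
  zify
  have h1 := two_mul_triangular k
  have h2 := sq_abs k
  have h3 : k ≤ |k| := le_abs_self k
  nlinarith [sq_nonneg (2 * |k| - 2 * M - 1), sq_nonneg (M : ℤ)]

theorem expSummable_triangular {p : ℝ} (hp0 : p ≠ 0) (hp1 : |p| < 1) (u v : ℝ) :
    ExpSummable (fun k => p ^ triangular k) u v := by
  intro z _
  have hpos : 0 < |p| := abs_pos.2 hp0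
  have hlog := log_abs_neg hp0 hp1
  -- Quadratic exponents beat any geometric rate: M is taken so large that decay like |p|^{M|k|}
  -- suffices at the given z.
  obtain ⟨M, hM⟩ := exists_nat_gt (|z| / (-Real.log |p|))
  rw [div_lt_iff₀ (by linarith)] at hM
  have hq0 : 0 < |p| ^ M := pow_pos hpos M
  refine expSummable_of_abs_le (C := (|p| ^ ((M + 1) ^ 2))⁻¹) hq0 (fun k => ?_) z ?_
  · rw [abs_pow, ← pow_mul, ← div_eq_inv_mul, le_div_iff₀ (by positivity), ← pow_add]
    exact pow_le_pow_of_le_one hpos.le hp1.le (triangular_ge M k)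
  · rw [Real.log_pow]
    have := neg_abs_le z
    have := le_abs_self z
    constructor <;> linarith

theorem expSummable_neg_one_triangular {p : ℝ} (hp0 : p ≠ 0) (hp1 : |p| < 1) (u v : ℝ) :
    ExpSummable (fun k => (-1) ^ k * p ^ triangular k) u v := by
  intro z hz
  refine Summable.of_norm (((expSummable_triangular hp0 hp1 u v) z hz).norm.congr fun k => ?_)
  simp

/-- `∑ p^{n²}`. -/
noncomputable def thetaSq (p : ℝ) : ℝ := ∑' k : ℤ, p ^ (k.natAbs ^ 2)

/-- `∑ p^{k(k-1)/2}`. -/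
noncomputable def thetaTri (p : ℝ) : ℝ := ∑' k : ℤ, p ^ triangular k

/-- `∑ (-1)^{k-1} k p^{k(k-1)/2}`. -/
noncomputable def thetaTriDeriv (p : ℝ) : ℝ := ∑' k : ℤ, -((-1) ^ k * k) * p ^ triangular k

theorem summable_thetaSq {p : ℝ} (hp0 : p ≠ 0) (hp1 : |p| < 1) :
    Summable fun k : ℤ => p ^ (k.natAbs ^ 2) := by
  have hlog := log_abs_neg hp0 hp1
  have h := expSummable_of_abs_le (c := fun k : ℤ => p ^ (k.natAbs ^ 2)) (C := 1) (abs_pos.2 hp0)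
    (fun k => by
      rw [one_mul, abs_pow]
      exact pow_le_pow_of_le_one (abs_nonneg p) hp1.le (Nat.le_self_pow two_ne_zero _)) 0
    ⟨hlog, by linarith⟩
  simpa using h

theorem summable_thetaTri {p : ℝ} (hp0 : p ≠ 0) (hp1 : |p| < 1) :
    Summable fun k : ℤ => p ^ triangular k := by
  have h := expSummable_triangular hp0 hp1 (-1) 1 0 ⟨by norm_num, by norm_num⟩
  simpa using h

theorem summable_thetaTriDeriv {p : ℝ} (hp0 : p ≠ 0) (hp1 : |p| < 1) :
    Summable fun k : ℤ => -((-1) ^ k * k) * p ^ triangular k := by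
  have h := (expSummable_neg_one_triangular hp0 hp1 (-1) 1).intCast_mul 0
    ⟨by norm_num, by norm_num⟩
  refine h.neg.congr fun k => ?_
  simp; ring

/-- The reflection k ↦ 1 - k preserves the exponent and reverses the sign. -/
theorem tsum_neg_one_triangular (p : ℝ) :
    ∑' k : ℤ, (-1) ^ k * p ^ triangular k = 0 := by
  have h : ∑' k : ℤ, (-1) ^ k * p ^ triangular k = -∑' k : ℤ, (-1) ^ k * p ^ triangular k := by
    rw [← tsum_neg]
    conv_lhs => rw [← (Equiv.subLeft (1 : ℤ)).tsum_eq]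
    refine tsum_congr fun k => ?_
    rw [Equiv.subLeft_apply, triangular_one_sub, zpow_sub₀ (by norm_num)]
    rcases Int.even_or_odd k with h | h <;> simp [h.neg_one_zpow]
  linarith

/-- The parametrization of pairs of integers by their half-sum and half-difference: the left
summand covers the pairs of equal parity, the right one those of different parity. -/
def parityEquiv : (ℤ × ℤ) ⊕ (ℤ × ℤ) ≃ ℤ × ℤ where
  toFun := Sum.elim (fun x => (x.1 + x.2, x.1 - x.2)) (fun x => (x.1 + x.2, 1 - (x.1 - x.2)))
  invFun y := if (y.1 + y.2) % 2 = 0 then Sum.inl ((y.1 + y.2) / 2, (y.1 - y.2) / 2)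
    else Sum.inr ((y.1 - y.2 + 1) / 2, (y.1 + y.2) / 2)
  left_inv := by
    rintro (⟨r, s⟩ | ⟨r, s⟩)
    · refine (if_pos (show (r + s + (r - s)) % 2 = 0 by omega)).trans ?_
      exact congrArg Sum.inl (Prod.ext (show (r + s + (r - s)) / 2 = r by omega)
        (show (r + s - (r - s)) / 2 = s by omega))
    · refine (if_neg (show ¬ (r + s + (1 - (r - s))) % 2 = 0 by omega)).trans ?_
      exact congrArg Sum.inr (Prod.ext (show (r + s - (1 - (r - s)) + 1) / 2 = r by omega)
        (show (r + s + (1 - (r - s))) / 2 = s by omega))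
  right_inv := by
    rintro ⟨j, k⟩
    simp only
    split_ifs with h
    · simp only [Sum.elim_inl]; congr 1 <;> omega
    · simp only [Sum.elim_inr]; congr 1 <;> omega

theorem hasSum_parity {f : ℤ × ℤ → ℝ} {a : ℝ} (hf : HasSum f a) :
    Summable (fun x : ℤ × ℤ => f (x.1 + x.2, x.1 - x.2)) ∧
    Summable (fun x : ℤ × ℤ => f (x.1 + x.2, 1 - (x.1 - x.2))) ∧
    a = ∑' x : ℤ × ℤ, f (x.1 + x.2, x.1 - x.2) +
      ∑' x : ℤ × ℤ, f (x.1 + x.2, 1 - (x.1 - x.2)) := by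
  have h := (parityEquiv.hasSum_iff (f := f)).2 hf
  have h1 : Summable (fun x : ℤ × ℤ => f (x.1 + x.2, x.1 - x.2)) :=
    h.summable.comp_injective Sum.inl_injective
  have h2 : Summable (fun x : ℤ × ℤ => f (x.1 + x.2, 1 - (x.1 - x.2))) :=
    h.summable.comp_injective Sum.inr_injective
  exact ⟨h1, h2, h.unique (HasSum.sum (f := f ∘ parityEquiv) h1.hasSum h2.hasSum)⟩

/-- The symmetry of g makes pairs of equal and of different parity contribute the same, so the
half-sum and half-difference parametrization of one class accounts for half of the product. -/
theorem mul_eq_two_mul_tsum {f g : ℤ → ℝ} {a b : ℝ} (hf : HasSum f a) (hg : HasSum g b)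
    (hsym : ∀ k, g (1 - k) = g k) :
    HasSum (fun x : ℤ × ℤ => f (x.1 + x.2) * g (x.1 - x.2)) (a * b / 2) := by
  obtain ⟨h1, -, h3⟩ := hasSum_parity (hasSum_prod_mul hf hg)
  simp only [hsym] at h1 h3
  refine h1.hasSum.congr_of_eq (fun _ => rfl) ?_
  rw [h3]; ring

theorem thetaTri_sq {p : ℝ} (hp0 : p ≠ 0) (hp1 : |p| < 1) :
    thetaTri p ^ 2 = 2 * thetaSq p * thetaTri (p ^ 2) := by
  have hp2 : |p ^ 2| < 1 := by rw [abs_pow]; exact pow_lt_one₀ (abs_nonneg p) hp1 two_ne_zero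
  have h1 := mul_eq_two_mul_tsum (summable_thetaTri hp0 hp1).hasSum
    (summable_thetaTri hp0 hp1).hasSum (fun k => by rw [triangular_one_sub])
  have h2 := hasSum_prod_mul (summable_thetaTri (pow_ne_zero 2 hp0) hp2).hasSum
    (summable_thetaSq hp0 hp1).hasSum
  have h3 := h1.unique (h2.congr_of_eq (fun x => by
    rw [← pow_add, triangular_add_sub, pow_add, pow_mul]) rfl)
  simp only [thetaTri, thetaSq]
  linarith

theorem neg_pow_natAbs_sq (p : ℝ) (k : ℤ) : (-p) ^ (k.natAbs ^ 2) = (-1) ^ k * p ^ (k.natAbs ^ 2) := by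
  rw [neg_pow]
  congr 1
  rcases Int.even_or_odd k with h | h
  · rw [h.neg_one_zpow, Even.neg_one_pow]
    exact (Int.natAbs_even.2 h).pow_of_ne_zero two_ne_zero
  · rw [h.neg_one_zpow, Odd.neg_one_pow]
    exact (Int.natAbs_odd.2 h).pow

/-- After the substitution k = r + s the linear factor splits. The part with s is a product
containing the alternating sum over r, which is zero, and the part with r gives the right-hand side.
-/
theorem thetaTriDeriv_mul_thetaTri {p : ℝ} (hp0 : p ≠ 0) (hp1 : |p| < 1) :
    thetaTriDeriv p * thetaTri p = 2 * thetaSq (-p) * thetaTriDeriv (p ^ 2) := by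
  have hp2 : |p ^ 2| < 1 := by rw [abs_pow]; exact pow_lt_one₀ (abs_nonneg p) hp1 two_ne_zero
  have hp20 := pow_ne_zero 2 hp0
  have h1 := mul_eq_two_mul_tsum (summable_thetaTriDeriv hp0 hp1).hasSum
    (summable_thetaTri hp0 hp1).hasSum (fun k => by rw [triangular_one_sub])
  have h2 := hasSum_prod_mul (summable_thetaTriDeriv hp20 hp2).hasSum
    (summable_thetaSq (neg_ne_zero.2 hp0) (by rwa [abs_neg])).hasSum
  have hs0 : Summable fun k : ℤ => (-1) ^ k * (p ^ 2) ^ triangular k := by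
    have := expSummable_neg_one_triangular hp20 hp2 (-1) 1 0 ⟨by norm_num, by norm_num⟩
    simpa using this
  have hs1 : Summable fun k : ℤ => k * (-p) ^ (k.natAbs ^ 2) := by
    have hlog := log_abs_neg hp0 hp1
    have h := (expSummable_of_abs_le (c := fun k : ℤ => (-p) ^ (k.natAbs ^ 2)) (C := 1)
      (abs_pos.2 hp0) (fun k => by
        rw [one_mul, abs_pow, abs_neg]
        exact pow_le_pow_of_le_one (abs_nonneg p) hp1.le
          (Nat.le_self_pow two_ne_zero _))).intCast_mul 0 ⟨hlog, by linarith⟩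
    simpa using h
  have h3 := hasSum_prod_mul hs0.hasSum hs1.hasSum
  rw [tsum_neg_one_triangular, zero_mul] at h3
  have h4 := h1.unique ((h2.sub h3).congr_of_eq (fun x => by
    have e1 : p ^ triangular (x.1 + x.2) * p ^ triangular (x.1 - x.2) =
        (p ^ 2) ^ triangular x.1 * p ^ (x.2.natAbs ^ 2) := by
      rw [← pow_add, triangular_add_sub, pow_add, pow_mul]
    rw [neg_pow_natAbs_sq, zpow_add₀ (by norm_num)]
    push_cast
    linear_combination (-((-1) ^ x.1 * (-1) ^ x.2 * ((x.1 : ℝ) + x.2))) * e1) rfl)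
  simp only [thetaTri, thetaSq, thetaTriDeriv]
  linarith

/-- Pairs of equal parity give the square at -p². Pairs of different parity cancel under x.1 ↦ 1 -
x.1, which swaps the two exponents and reverses the sign. -/
theorem thetaSq_mul_thetaSq_neg {p : ℝ} (hp0 : p ≠ 0) (hp1 : |p| < 1) :
    thetaSq p * thetaSq (-p) = thetaSq (-p ^ 2) ^ 2 := by
  have hp2 : |(-p ^ 2)| < 1 := by
    rw [abs_neg, abs_pow]; exact pow_lt_one₀ (abs_nonneg p) hp1 two_ne_zero
  have hs := summable_thetaSq (neg_ne_zero.2 (pow_ne_zero 2 hp0)) hp2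
  obtain ⟨h1, h2, h3⟩ := hasSum_parity (hasSum_prod_mul (summable_thetaSq hp0 hp1).hasSum
    (summable_thetaSq (neg_ne_zero.2 hp0) (by rwa [abs_neg])).hasSum)
  have h4 : ∑' x : ℤ × ℤ, p ^ ((x.1 + x.2).natAbs ^ 2) * (-p) ^ ((x.1 - x.2).natAbs ^ 2) =
      thetaSq (-p ^ 2) * thetaSq (-p ^ 2) := by
    refine HasSum.tsum_eq ((hasSum_prod_mul hs.hasSum hs.hasSum).congr_of_eq (fun x => ?_) rfl)
    simp only [neg_pow_natAbs_sq]
    have e1 : p ^ ((x.1 + x.2).natAbs ^ 2) * p ^ ((x.1 - x.2).natAbs ^ 2) =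
        (p ^ 2) ^ (x.1.natAbs ^ 2) * (p ^ 2) ^ (x.2.natAbs ^ 2) := by
      rw [← pow_mul, ← pow_mul, ← pow_add, ← pow_add]
      congr 1
      zify
      simp only [sq_abs]; ring
    have e2 : (-1 : ℝ) ^ (x.1 - x.2) = (-1) ^ x.1 * (-1) ^ x.2 := by
      rw [zpow_sub₀ (by norm_num)]
      rcases Int.even_or_odd x.2 with h | h <;> simp [h.neg_one_zpow, div_neg]
    rw [e2]
    linear_combination ((-1) ^ x.1 * (-1) ^ x.2) * e1
  have h5 : ∑' x : ℤ × ℤ, p ^ ((x.1 + x.2).natAbs ^ 2) * (-p) ^ ((1 - (x.1 - x.2)).natAbs ^ 2) =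
      -∑' x : ℤ × ℤ, p ^ ((x.1 + x.2).natAbs ^ 2) * (-p) ^ ((1 - (x.1 - x.2)).natAbs ^ 2) := by
    rw [← tsum_neg]
    conv_lhs => rw [← ((Equiv.subLeft (1 : ℤ)).prodCongr (Equiv.refl ℤ)).tsum_eq]
    refine tsum_congr fun x => ?_
    simp only [Equiv.prodCongr_apply, Prod.map_fst, Prod.map_snd, Equiv.subLeft_apply,
      Equiv.refl_apply, neg_pow_natAbs_sq]
    have e1 : (1 - x.1 + x.2).natAbs = (1 - (x.1 - x.2)).natAbs := by congr 1; ring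
    have e2 : (1 - (1 - x.1 - x.2)).natAbs = (x.1 + x.2).natAbs := by congr 1; ring
    have e3 : (-1 : ℝ) ^ (1 - (1 - x.1 - x.2)) = -(-1) ^ (1 - (x.1 - x.2)) := by
      rw [show 1 - (1 - x.1 - x.2) = (1 - (x.1 - x.2)) + (2 * x.1 - 1) by ring,
        zpow_add₀ (by norm_num), (show Odd (2 * x.1 - 1) from ⟨x.1 - 1, by ring⟩).neg_one_zpow]
      ring
    rw [e1, e2, e3]
    ring
  rw [sq, ← h4]
  simp only [thetaSq] at h3 ⊢
  linarith

/-! ### Behaviour at the origin -/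

theorem continuousAt_tsum_mul_pow {c : ℤ → ℝ} {e : ℤ → ℕ} {r : ℝ} (hr : 0 < r)
    (h : Summable fun k => c k * r ^ e k) :
    ContinuousAt (fun x : ℝ => ∑' k, c k * x ^ e k) 0 := by
  refine tendsto_tsum_of_dominated_convergence (bound := fun k => ‖c k * r ^ e k‖) h.norm
    (fun k => ?_) ?_
  · exact ((continuous_pow (e k)).tendsto 0).const_mul (c k)
  · filter_upwards [Metric.ball_mem_nhds (0 : ℝ) hr] with x hx k
    rw [norm_mul, norm_mul, norm_pow, norm_pow]
    have : ‖x‖ ≤ ‖r‖ := by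
      rw [Real.norm_of_nonneg hr.le]
      exact (mem_ball_zero_iff.1 hx).le
    gcongr

theorem triangular_eq_zero {k : ℤ} (h : triangular k = 0) : k ∈ ({0, 1} : Finset ℤ) := by
  have h1 := two_mul_triangular k
  rw [h] at h1
  simp only [Finset.mem_insert, Finset.mem_singleton]
  rcases mul_eq_zero.1 (by simpa using h1.symm : k * (k - 1) = 0) with h | h
  · exact Or.inl h
  · exact Or.inr (by omega)

theorem triangular_zero : triangular 0 = 0 := by decide

theorem triangular_one : triangular 1 = 0 := by decide

theorem tendsto_thetaSq : Tendsto thetaSq (𝓝 0) (𝓝 1) := by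
  have h := continuousAt_tsum_mul_pow (c := fun _ => 1) (e := fun k => k.natAbs ^ 2) (r := 1 / 2)
    (by norm_num) (by simpa using summable_thetaSq (p := 1 / 2) (by norm_num) (by norm_num [abs_of_pos]))
  simp only [one_mul] at h
  convert! h.tendsto using 2
  rw [tsum_eq_single 0]
  · simp
  · intro k hk
    exact zero_pow (pow_ne_zero 2 (by simpa using hk))

theorem tendsto_thetaTri : Tendsto thetaTri (𝓝 0) (𝓝 2) := by
  have h := continuousAt_tsum_mul_pow (c := fun _ => 1) (e := triangular) (r := 1 / 2)
    (by norm_num) (by simpa using summable_thetaTri (p := 1 / 2) (by norm_num) (by norm_num [abs_of_pos]))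
  simp only [one_mul] at h
  convert! h.tendsto using 2
  rw [tsum_eq_sum (s := {0, 1})]
  · simp [triangular_zero, triangular_one]; norm_num
  · intro k hk
    exact zero_pow fun h => hk (triangular_eq_zero h)

theorem tendsto_thetaTriDeriv : Tendsto thetaTriDeriv (𝓝 0) (𝓝 1) := by
  have h := continuousAt_tsum_mul_pow (c := fun k => -((-1) ^ k * k)) (e := triangular)
    (r := 1 / 2) (by norm_num)
    (summable_thetaTriDeriv (p := 1 / 2) (by norm_num) (by norm_num [abs_of_pos]))
  convert! h.tendsto using 2
  rw [tsum_eq_sum (s := {0, 1})]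
  · simp [triangular_zero, triangular_one]
  · intro k hk
    rw [zero_pow fun h => hk (triangular_eq_zero h), mul_zero]

/-! ### Nonvanishing of the theta constants and their evaluation by doubling -/

theorem thetaSq_pos {q : ℝ} (hq0 : 0 < q) (hq1 : q < 1) : 0 < thetaSq q :=
  (summable_thetaSq hq0.ne' (by rwa [abs_of_pos hq0])).tsum_pos (fun k => by positivity) 0
    (by simp)

theorem thetaTri_pos {q : ℝ} (hq0 : 0 < q) (hq1 : q < 1) : 0 < thetaTri q :=
  (summable_thetaTri hq0.ne' (by rwa [abs_of_pos hq0])).tsum_pos (fun k => by positivity) 0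
    (by simp [triangular_zero])

theorem abs_thetaSq_neg_le {q : ℝ} (hq0 : 0 < q) (hq1 : q < 1) :
    |thetaSq (-q)| ≤ thetaSq q := by
  have h := summable_thetaSq (p := -q) (by simpa using hq0.ne') (by rwa [abs_neg, abs_of_pos hq0])
  have h1 := norm_tsum_le_tsum_norm h.norm
  simpa [thetaSq, abs_of_pos hq0] using h1

theorem tendsto_pow_two_pow {q : ℝ} (hq0 : 0 < q) (hq1 : q < 1) :
    Tendsto (fun n : ℕ => q ^ 2 ^ n) atTop (𝓝 0) :=
  (tendsto_pow_atTop_nhds_zero_of_lt_one hq0.le hq1).comp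
    (tendsto_pow_atTop_atTop_of_one_lt one_lt_two)

/-- By the product relation, a zero at -q would propagate to -q², -q⁴, …, while the values along
this sequence tend to 1. -/
theorem thetaSq_neg_ne_zero {q : ℝ} (hq0 : 0 < q) (hq1 : q < 1) : thetaSq (-q) ≠ 0 := by
  intro h
  have hn : ∀ n : ℕ, thetaSq (-q ^ 2 ^ n) = 0 := by
    intro n
    induction n with
    | zero => simpa using h
    | succ n ih =>
      have hlt : q ^ 2 ^ n < 1 := pow_lt_one₀ hq0.le hq1 (by positivity)
      have := thetaSq_mul_thetaSq_neg (p := q ^ 2 ^ n) (by positivity)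
        (by rwa [abs_of_pos (by positivity)])
      rw [ih, mul_zero, ← pow_mul, ← pow_succ] at this
      exact pow_eq_zero_iff two_ne_zero |>.1 this.symm
  have h1 : Tendsto (fun n : ℕ => thetaSq (-q ^ 2 ^ n)) atTop (𝓝 1) :=
    tendsto_thetaSq.comp (by simpa using (tendsto_pow_two_pow hq0 hq1).neg)
  simp only [hn] at h1
  exact zero_ne_one (tendsto_nhds_unique tendsto_const_nhds h1)

/-- The normalized defect F satisfies F(x) = (thetaSq(-x) / thetaSq(x)) F(x²) with a factor of
absolute value at most 1. So |F(q)| is bounded by |F(q^{2^n})|, which tends to 0. -/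
theorem two_mul_thetaTriDeriv_of_pos {q : ℝ} (hq0 : 0 < q) (hq1 : q < 1) :
    2 * thetaTriDeriv q = thetaSq (-q) ^ 2 * thetaTri q := by
  set F : ℝ → ℝ := fun x => (2 * thetaTriDeriv x - thetaSq (-x) ^ 2 * thetaTri x) / thetaTri x
    with hF
  have hstep : ∀ x, 0 < x → x < 1 → |F x| ≤ |F (x ^ 2)| := by
    intro x hx0 hx1
    have habs : |x| < 1 := by rwa [abs_of_pos hx0]
    have hx2 : x ^ 2 < 1 := pow_lt_one₀ hx0.le hx1 two_ne_zero
    have t0 := thetaTri_pos hx0 hx1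
    have t2 := thetaTri_pos (pow_pos hx0 2) hx2
    have p0 := thetaSq_pos hx0 hx1
    have e1 := thetaTri_sq hx0.ne' habs
    have e2 := thetaTriDeriv_mul_thetaTri hx0.ne' habs
    have e3 := thetaSq_mul_thetaSq_neg hx0.ne' habs
    have h : F x = thetaSq (-x) / thetaSq x * F (x ^ 2) := by
      simp only [hF]
      rw [div_mul_div_comm, div_eq_div_iff t0.ne' (by positivity), ← mul_right_inj' t0.ne']
      rw [← e3]
      linear_combination (2 * thetaSq x * thetaTri (x ^ 2)) * e2 -
        (thetaSq (-x) * (2 * thetaTriDeriv (x ^ 2))) * e1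
    rw [h, abs_mul, abs_div, abs_of_pos p0]
    refine mul_le_of_le_one_left (abs_nonneg _) ?_
    rw [div_le_one p0]
    exact abs_thetaSq_neg_le hx0 hx1
  have hiter : ∀ n : ℕ, |F q| ≤ |F (q ^ 2 ^ n)| := by
    intro n
    induction n with
    | zero => simp
    | succ n ih =>
      refine ih.trans ?_
      have := hstep (q ^ 2 ^ n) (by positivity) (pow_lt_one₀ hq0.le hq1 (by positivity))
      rwa [← pow_mul, ← pow_succ] at this
  have hlim : Tendsto F (𝓝 0) (𝓝 0) := by
    have hneg : Tendsto (fun x : ℝ => thetaSq (-x)) (𝓝 0) (𝓝 1) :=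
      tendsto_thetaSq.comp (by simpa using (continuous_neg.tendsto (0 : ℝ)))
    have := ((tendsto_thetaTriDeriv.const_mul 2).sub ((hneg.pow 2).mul tendsto_thetaTri)).div
      tendsto_thetaTri two_ne_zero
    rw [one_pow, one_mul, mul_one, sub_self, zero_div] at this
    exact this
  have h0 : |F q| ≤ 0 := by
    have := (hlim.comp (tendsto_pow_two_pow hq0 hq1)).abs
    rw [abs_zero] at this
    exact ge_of_tendsto' this hiter
  have h1 : F q = 0 := abs_nonpos_iff.1 h0
  have t0 := thetaTri_pos hq0 hq1
  rcases div_eq_zero_iff.1 h1 with h | h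
  · linarith
  · exact absurd h t0.ne'

theorem thetaTri_neg_ne_zero {q : ℝ} (hq0 : 0 < q) (hq1 : q < 1) : thetaTri (-q) ≠ 0 := by
  intro h
  have e := thetaTri_sq (p := -q) (by simpa using hq0.ne') (by rwa [abs_neg, abs_of_pos hq0])
  rw [h, neg_sq] at e
  have t := thetaTri_pos (pow_pos hq0 2) (pow_lt_one₀ hq0.le hq1 two_ne_zero)
  have := thetaSq_neg_ne_zero hq0 hq1
  have : 2 * thetaSq (-q) * thetaTri (q ^ 2) ≠ 0 := by positivity
  exact this (by rw [← e]; ring)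

/-- `2 ∑ (-1)^{k-1} k p^{k(k-1)/2} = (∑ q^{n²})² ∑ p^{k(k-1)/2}` for `p = -q`. -/
theorem two_mul_thetaTriDeriv_neg {q : ℝ} (hq0 : 0 < q) (hq1 : q < 1) :
    2 * thetaTriDeriv (-q) = thetaSq q ^ 2 * thetaTri (-q) := by
  have hn0 : -q ≠ 0 := by simpa using hq0.ne'
  have habs : |(-q)| < 1 := by rwa [abs_neg, abs_of_pos hq0]
  have e1 := thetaTri_sq hn0 habs
  have e2 := thetaTriDeriv_mul_thetaTri hn0 habs
  have e3 := thetaSq_mul_thetaSq_neg hn0 habs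
  -- One doubling step takes -q to the positive number q², where the identity is already known.
  have e4 := two_mul_thetaTriDeriv_of_pos (pow_pos hq0 2) (pow_lt_one₀ hq0.le hq1 two_ne_zero)
  rw [neg_sq] at e1 e2 e3
  rw [neg_neg] at e2 e3
  have t := thetaTri_neg_ne_zero hq0 hq1
  rw [← mul_right_inj' t]
  linear_combination 2 * e2 - thetaSq q ^ 2 * e1 + 2 * thetaSq q * e4 -
    2 * thetaSq q * thetaTri (q ^ 2) * e3

/-! ### The derivative of the Lambert series at the origin -/

section Lambert

variable {p : ℝ}

theorem hasSum_stepCoeff_natCast {x : ℝ} (hx : |x| < 1) :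
    HasSum (fun k : ℕ => stepCoeff k * x ^ k) ((1 - x)⁻¹ - 1 / 2) := by
  have h1 := (hasSum_geometric_of_abs_lt_one hx).sub (hasSum_ite_eq (0 : ℕ) (1 / 2 : ℝ))
  refine h1.congr_of_eq (fun k => ?_) rfl
  rcases k with _ | k
  · simp [stepCoeff]; norm_num
  · rw [stepCoeff, if_neg (by omega), if_neg (by omega), if_neg (by omega)]; ring

theorem hasSum_stepCoeff {s z : ℝ} (hs : |s| = 1) (hz : z < 0) :
    HasSum (fun k : ℤ => s ^ k * stepCoeff k * Real.exp (k * z))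
      ((1 - s * Real.exp z)⁻¹ - 1 / 2) := by
  have hx : |s * Real.exp z| < 1 := by
    rw [abs_mul, hs, one_mul, Real.abs_exp, Real.exp_lt_one_iff]
    exact hz
  refine (Function.Injective.hasSum_iff (f := fun k : ℤ => s ^ k * stepCoeff k * Real.exp (k * z))
    (g := fun n : ℕ => (n : ℤ)) Nat.cast_injective fun k hk => ?_).1 ?_
  · have hk : k < 0 := by
      by_contra h
      exact hk ⟨k.toNat, Int.toNat_of_nonneg (by omega)⟩
    rw [stepCoeff, if_pos hk]; ring
  · refine (hasSum_stepCoeff_natCast hx).congr_of_eq (fun k => ?_) rfl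
    simp only [Function.comp_apply, zpow_natCast, Int.cast_natCast]
    rw [mul_pow, ← Real.exp_nat_mul]; ring

theorem expSeries_stepCoeff {z : ℝ} (hz : z < 0) :
    expSeries (fun k => (-1) ^ k * stepCoeff k) z = 1 / 2 - Real.sigmoid z := by
  refine (hasSum_stepCoeff (s := -1) (by norm_num) hz).tsum_eq.trans ?_
  rw [← sub_eq_zero, Real.sigmoid_def, Real.exp_neg]
  have := Real.exp_pos z
  have : 1 + Real.exp z ≠ 0 := by positivity
  rw [show 1 - -1 * Real.exp z = 1 + Real.exp z by ring]
  field_simp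
  ring

/-- The part of the Lambert series that is regular at the origin. -/
noncomputable def lambertReg (p : ℝ) : ℝ → ℝ :=
  expSeries fun k => (-1) ^ k * (lambertCoeff p k - stepCoeff k)

theorem lambertL_eq (hp0 : p ≠ 0) (hp1 : |p| < 1) {z : ℝ} (hz : z ∈ Set.Ioo (Real.log |p|) 0) :
    lambertL p z = 1 / 2 - Real.sigmoid z + lambertReg p z := by
  rw [← expSeries_stepCoeff hz.2]
  have hlog := log_abs_neg hp0 hp1
  refine HasSum.tsum_eq (((expSummable_stepCoeff _).hasSum hz).add
    ((expSummable_lambertCoeff_sub_stepCoeff hp0 hp1).hasSum ⟨hz.1, by linarith [hz.2]⟩)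
    |>.congr_of_eq (fun k => ?_) rfl)
  ring

/-- `∑ (-1)^k p^{k(k+1)/2} / (1 + p^k)`. -/
noncomputable def lambertTheta (p : ℝ) : ℝ :=
  ∑' k : ℤ, ((-1) ^ k * lambertCoeff p k) * p ^ triangular (0 - k)

/-- This expresses L as a constant times a quotient of theta series. Since (1 + p^k) g_k = 1, the
combination X_{n+1} + p^n X_n reduces to an alternating theta sum, which is zero; the resulting
recurrence determines every X_n from X_0. -/
theorem hasSum_lambertCoeff_triangular (hp0 : p ≠ 0) (hp1 : |p| < 1) (n : ℤ) :
    HasSum (fun k : ℤ => ((-1) ^ k * lambertCoeff p k) * p ^ triangular (n - k))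
      (lambertTheta p * ((-1) ^ n * p ^ triangular n)) := by
  have hs : ∀ n : ℤ, Summable fun k : ℤ =>
      ((-1) ^ k * lambertCoeff p k) * p ^ triangular (n - k) := fun n =>
    (expSummable_lambertCoeff hp0 hp1).summable_conv (expSummable_triangular hp0 hp1 _ _)
      (log_abs_neg hp0 hp1) n
  set X : ℤ → ℝ := fun n => ∑' k : ℤ, ((-1) ^ k * lambertCoeff p k) * p ^ triangular (n - k) with hX
  have hz : ∀ n : ℤ, HasSum (fun k : ℤ => (-1) ^ k * p ^ triangular (n + 1 - k)) 0 := by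
    intro n
    have h0 : HasSum (fun k : ℤ => (-1) ^ k * p ^ triangular k) 0 := by
      have := (expSummable_neg_one_triangular hp0 hp1 (-1) 1).hasSum (z := 0)
        ⟨by norm_num, by norm_num⟩
      simp only [mul_zero, Real.exp_zero, mul_one, expSeries] at this
      rwa [tsum_neg_one_triangular] at this
    have h1 := ((Equiv.subLeft (n + 1)).hasSum_iff
      (f := fun k : ℤ => (-1) ^ k * p ^ triangular k)).2 h0
    refine (h1.mul_left ((-1) ^ (n + 1))).congr_of_eq (fun k => ?_) (by ring)
    simp only [Function.comp_apply, Equiv.subLeft_apply]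
    rw [← mul_assoc, ← zpow_add₀ (by norm_num)]
    congr 1
    rw [show n + 1 + (n + 1 - k) = 2 * (n + 1 - k) + k by ring, zpow_add₀ (by norm_num),
      (even_two_mul _).neg_one_zpow, one_mul]
  have hrec : ∀ n, X (n + 1) = -(p ^ n * X n) := by
    intro n
    have h1 := (hs (n + 1)).hasSum.add ((hs n).hasSum.mul_left (p ^ n))
    have h2 := h1.unique ((hz n).congr_of_eq (fun k => ?_) rfl)
    · simp only [hX]; linarith
    · have e1 : p ^ triangular (n + 1 - k) = p ^ (n - k) * p ^ triangular (n - k) := by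
        rw [show n + 1 - k = (n - k) + 1 by ring, triangular_add_one p hp0]
      have e2 : p ^ n = p ^ (n - k) * p ^ k := by rw [← zpow_add₀ hp0]; congr 1; ring
      have e3 : lambertCoeff p k * (1 + p ^ k) = 1 := by
        rw [lambertCoeff, one_div_mul_cancel (one_add_zpow_ne_zero hp0 hp1 k)]
      rw [e1, e2]
      linear_combination ((-1) ^ k * p ^ (n - k) * p ^ triangular (n - k)) * e3
  have hX0 : X 0 = lambertTheta p := rfl
  have hval : ∀ n, X n = lambertTheta p * ((-1) ^ n * p ^ triangular n) := by
    intro n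
    induction n using Int.induction_on with
    | zero => rw [hX0]; simp [triangular_zero]
    | succ n ih =>
      rw [hrec, ih, triangular_add_one p hp0, zpow_add_one₀ (by norm_num)]; ring
    | pred n ih =>
      have h1 := hrec (-(n : ℤ) - 1)
      have h2 := triangular_add_one p hp0 (-(n : ℤ) - 1)
      have h3 : (-1 : ℝ) ^ (-(n : ℤ) - 1 + 1) = (-1) ^ (-(n : ℤ) - 1) * (-1) :=
        zpow_add_one₀ (by norm_num) _
      rw [sub_add_cancel] at h1 h2 h3
      have h4 : p ^ (-(n : ℤ) - 1) ≠ 0 := zpow_ne_zero _ hp0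
      rw [← mul_right_inj' h4]
      rw [ih, h2, h3] at h1
      linear_combination h1
  rw [← hval]
  exact (hs n).hasSum

theorem eq_of_hasDerivAt_of_eqOn_left {F G : ℝ → ℝ} {a b u : ℝ} (hu : u < 0)
    (hF : HasDerivAt F a 0) (hG : HasDerivAt G b 0) (h : ∀ z ∈ Set.Ioo u 0, F z = G z) :
    a = b := by
  have hmem : ∀ᶠ z in 𝓝[<] (0 : ℝ), z ∈ Set.Ioo u 0 := Ioo_mem_nhdsLT hu
  have h0 : F 0 = G 0 := by
    have h1 : Tendsto F (𝓝[<] 0) (𝓝 (F 0)) := hF.continuousAt.tendsto.mono_left nhdsWithin_le_nhds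
    have h2 : Tendsto G (𝓝[<] 0) (𝓝 (G 0)) := hG.continuousAt.tendsto.mono_left nhdsWithin_le_nhds
    exact tendsto_nhds_unique (h1.congr' (hmem.mono h)) h2
  have h1 : HasDerivWithinAt F b (Set.Iio 0) 0 :=
    (hG.hasDerivWithinAt (s := Set.Iio 0)).congr_of_eventuallyEq (hmem.mono h) h0
  exact (uniqueDiffWithinAt_Iio (0 : ℝ)).eq_deriv _ hF.hasDerivWithinAt h1

theorem expSeries_zero (c : ℤ → ℝ) : expSeries c 0 = ∑' k, c k := by
  simp [expSeries]

theorem hasDerivAt_theta (hp0 : p ≠ 0) (hp1 : |p| < 1) :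
    HasDerivAt (expSeries fun k => (-1) ^ k * p ^ triangular k) (-thetaTriDeriv p) 0 := by
  have h := (expSummable_neg_one_triangular hp0 hp1 (-1) 1).hasDerivAt (z := 0)
    ⟨by norm_num, by norm_num⟩
  convert! h using 1
  rw [expSeries_zero, thetaTriDeriv, ← tsum_neg]
  exact tsum_congr fun k => by ring

theorem theta_zero : expSeries (fun k => (-1) ^ k * p ^ triangular k) 0 = 0 := by
  rw [expSeries_zero, tsum_neg_one_triangular]

theorem hasDerivAt_lambertReg (hp0 : p ≠ 0) (hp1 : |p| < 1) :
    HasDerivAt (lambertReg p)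
      (∑' k : ℤ, (k : ℝ) * ((-1) ^ k * (lambertCoeff p k - stepCoeff k))) 0 := by
  have hlog := log_abs_neg hp0 hp1
  have h := (expSummable_lambertCoeff_sub_stepCoeff hp0 hp1).hasDerivAt (z := 0)
    ⟨hlog, by linarith⟩
  rwa [expSeries_zero] at h

theorem lambertReg_zero (hp0 : p ≠ 0) (hp1 : |p| < 1) : lambertReg p 0 = 0 := by
  rw [lambertReg, expSeries_zero]
  have h : ∑' k : ℤ, (-1) ^ k * (lambertCoeff p k - stepCoeff k) =
      -∑' k : ℤ, (-1) ^ k * (lambertCoeff p k - stepCoeff k) := by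
    rw [← tsum_neg]
    conv_lhs => rw [← (Equiv.neg ℤ).tsum_eq]
    refine tsum_congr fun k => ?_
    rw [Equiv.neg_apply, lambertCoeff_neg hp0 hp1, stepCoeff_neg]
    rcases Int.even_or_odd k with h | h
    · rw [h.neg_one_zpow, h.neg.neg_one_zpow]; ring
    · rw [h.neg_one_zpow, h.neg.neg_one_zpow]; ring
  linarith

/-- Comparison of derivatives at the zero of the Lambert series. -/
theorem lambert_deriv_mul_thetaTri (hp0 : p ≠ 0) (hp1 : |p| < 1) :
    (1 / 4 - ∑' k : ℤ, (k : ℝ) * ((-1) ^ k * (lambertCoeff p k - stepCoeff k))) * thetaTri p =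
      lambertTheta p * thetaTriDeriv p := by
  have hlog := log_abs_neg hp0 hp1
  have hA := (expSummable_triangular hp0 hp1 (-1) 1).hasDerivAt (z := 0)
    ⟨by norm_num, by norm_num⟩
  have hσ := Real.hasDerivAt_sigmoid 0
  have hE : HasDerivAt (fun z => 1 / 2 - Real.sigmoid z + lambertReg p z) _ 0 :=
    (hσ.const_sub (1 / 2)).add (hasDerivAt_lambertReg hp0 hp1)
  have h := eq_of_hasDerivAt_of_eqOn_left hlog (hE.mul hA)
    ((hasDerivAt_theta hp0 hp1).const_mul (lambertTheta p)) fun z hz => by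
      have h1 := (expSummable_lambertCoeff hp0 hp1).expSeries_mul
        (expSummable_triangular hp0 hp1 _ _) (hasSum_lambertCoeff_triangular hp0 hp1) hz
      have h2 : expSeries (fun n => lambertTheta p * ((-1) ^ n * p ^ triangular n)) z =
          lambertTheta p * expSeries (fun n => (-1) ^ n * p ^ triangular n) z := by
        rw [expSeries, expSeries, ← tsum_mul_left]
        exact tsum_congr fun k => by ring
      rw [← h2, ← h1, Pi.mul_apply, ← lambertL_eq hp0 hp1 hz]
      rfl
  rw [lambertReg_zero hp0 hp1, Real.sigmoid_zero, expSeries_zero] at h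
  rw [thetaTri]
  linarith

/-- Comparison of derivatives at the pole of the Lambert series. -/
theorem thetaTriDeriv_eq_lambertTheta_mul (hp0 : p ≠ 0) (hp1 : |p| < 1) :
    thetaTriDeriv p = lambertTheta p * thetaTri p := by
  have hlog := log_abs_neg hp0 hp1
  have hA := (expSummable_triangular hp0 hp1 (-1) 1).hasDerivAt (z := 0)
    ⟨by norm_num, by norm_num⟩
  have hexp : HasDerivAt (fun z : ℝ => 1 - Real.exp z) (-1) 0 := by
    simpa using (Real.hasDerivAt_exp 0).const_sub 1
  have hreg : ExpSummable (fun k => lambertCoeff p k - stepCoeff k)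
      (Real.log |p|) (-Real.log |p|) :=
    expSummable_of_abs_le (abs_pos.2 hp0) (abs_lambertCoeff_sub_stepCoeff_le hp0 hp1)
  have hD := hreg.hasDerivAt (z := 0) ⟨hlog, by linarith⟩
  set D := expSeries fun k => lambertCoeff p k - stepCoeff k with hDdef
  -- Dropping the signs (-1)^k shifts L by half a period and puts its pole at z = 0. This function
  -- is the shifted series multiplied by 1 - e^z, which removes the pole.
  have hG : HasDerivAt (fun z => (1 - Real.exp z) * (D z - 1 / 2) + 1) _ 0 :=
    (hexp.mul (hD.sub_const (1 / 2))).add_const 1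
  have hL : ∀ z ∈ Set.Ioo (Real.log |p|) 0,
      HasSum (fun k => lambertCoeff p k * Real.exp (k * z)) ((1 - Real.exp z)⁻¹ - 1 / 2 + D z) := by
    intro z hz
    have h1 := hasSum_stepCoeff (s := 1) (by norm_num) hz.2
    have h2 := hreg.hasSum (z := z) ⟨hz.1, by linarith [hz.2]⟩
    refine (h1.add h2).congr_of_eq (fun k => ?_) ?_
    · simp; ring
    · rw [one_mul]
  have h := eq_of_hasDerivAt_of_eqOn_left hlog (hG.mul (hasDerivAt_theta hp0 hp1))
    ((hexp.mul hA).const_mul (lambertTheta p)) fun z hz => by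
      have h1 : expSeries (fun k => lambertCoeff p k) z *
          expSeries (fun k => (-1) ^ k * p ^ triangular k) z =
          expSeries (fun n => lambertTheta p * p ^ triangular n) z := by
        refine ExpSummable.expSeries_mul (u := Real.log |p|) (v := 0) (fun z hz => (hL z hz).summable)
          (expSummable_neg_one_triangular hp0 hp1 _ _) (fun n => ?_) hz
        -- Multiplication by (-1)^n moves the alternating sign from the Lambert coefficients to the
        -- theta coefficients.
        refine ((hasSum_lambertCoeff_triangular hp0 hp1 n).mul_left ((-1) ^ n)).congr_of_eq
          (fun k => ?_) ?_
        · rcases Int.even_or_odd n with h | h <;> rcases Int.even_or_odd k with h' | h'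
          · rw [(h.sub h').neg_one_zpow, h.neg_one_zpow, h'.neg_one_zpow]; ring
          · rw [(h.sub_odd h').neg_one_zpow, h.neg_one_zpow, h'.neg_one_zpow]; ring
          · rw [(h.sub_even h').neg_one_zpow, h.neg_one_zpow, h'.neg_one_zpow]; ring
          · rw [(h.sub_odd h').neg_one_zpow, h.neg_one_zpow, h'.neg_one_zpow]; ring
        · rcases Int.even_or_odd n with h | h <;> rw [h.neg_one_zpow] <;> ring
      have h2 : expSeries (fun n => lambertTheta p * p ^ triangular n) z =
          lambertTheta p * expSeries (fun n => p ^ triangular n) z := by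
        rw [expSeries, expSeries, ← tsum_mul_left]
        exact tsum_congr fun k => by ring
      have h3 : expSeries (fun k => lambertCoeff p k) z = (1 - Real.exp z)⁻¹ - 1 / 2 + D z :=
        (hL z hz).tsum_eq
      have h4 : 1 - Real.exp z ≠ 0 := by
        have := Real.exp_lt_one_iff.2 hz.2
        linarith
      rw [h2, h3] at h1
      simp only [Pi.mul_apply]
      rw [show lambertTheta p * ((1 - Real.exp z) * expSeries (fun n => p ^ triangular n) z) =
        (1 - Real.exp z) * (lambertTheta p * expSeries (fun n => p ^ triangular n) z) by ring, ← h1]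
      field_simp
      ring
  rw [theta_zero, Real.exp_zero, expSeries_zero fun k => p ^ triangular k] at h
  rw [thetaTri]
  linarith

/-- Jacobi's four square theorem in terms of the Lambert series for `p = -q`. -/
theorem lambert_deriv_eq {q : ℝ} (hq0 : 0 < q) (hq1 : q < 1) :
    1 / 2 - 2 * ∑' k : ℤ, (k : ℝ) * ((-1) ^ k * (lambertCoeff (-q) k - stepCoeff k)) =
      thetaSq q ^ 4 / 2 := by
  have hn0 : -q ≠ 0 := by simpa using hq0.ne'
  have habs : |(-q)| < 1 := by rwa [abs_neg, abs_of_pos hq0]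
  have h1 := lambert_deriv_mul_thetaTri hn0 habs
  have h2 := thetaTriDeriv_eq_lambertTheta_mul hn0 habs
  have h3 := two_mul_thetaTriDeriv_neg hq0 hq1
  have t := thetaTri_neg_ne_zero hq0 hq1
  have h4 : lambertTheta (-q) = thetaSq q ^ 2 / 2 := by
    rw [← mul_right_inj' t]; linarith
  rw [h2] at h1
  have h5 : 1 / 4 - ∑' k : ℤ, (k : ℝ) * ((-1) ^ k * (lambertCoeff (-q) k - stepCoeff k)) =
      lambertTheta (-q) ^ 2 := by
    rw [← mul_right_inj' t]; linarith
  rw [h4] at h5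
  linarith

end Lambert

/-! ### Derivatives of powers of the solution of a differential equation -/

/-- `T` solves `T'' = β T + T³ / 2` to the left of the origin, with `T(0-) = 0`, `T'(0-) = a`. -/
structure IsOdeSolution (T T' : ℝ → ℝ) (u a β : ℝ) : Prop where
  neg : u < 0
  hasDerivAt : ∀ z ∈ Set.Ioo u 0, HasDerivAt T (T' z) z
  hasDerivAt' : ∀ z ∈ Set.Ioo u 0, HasDerivAt T' (β * T z + T z ^ 3 / 2) z
  tendsto : Tendsto T (𝓝[<] 0) (𝓝 0)
  tendsto' : Tendsto T' (𝓝[<] 0) (𝓝 a)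

/-- This is the first integral of the equation: the energy F has zero derivative, and its constant
value is its limit a² at 0-. -/
theorem IsOdeSolution.sq_eq {T T' : ℝ → ℝ} {u a β : ℝ} (h : IsOdeSolution T T' u a β) {z : ℝ}
    (hz : z ∈ Set.Ioo u 0) : T' z ^ 2 = a ^ 2 + β * T z ^ 2 + T z ^ 4 / 4 := by
  set F : ℝ → ℝ := fun z => T' z ^ 2 - β * T z ^ 2 - T z ^ 4 / 4 with hF
  have hder : ∀ z ∈ Set.Ioo u 0, HasDerivAt F 0 z := by
    intro z hz
    have h1 := h.hasDerivAt z hz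
    have h2 := h.hasDerivAt' z hz
    have h3 := ((h2.pow 2).sub ((h1.pow 2).const_mul β)).sub ((h1.pow 4).div_const 4)
    convert! h3 using 1
    push_cast; ring
  have hconst : ∀ y ∈ Set.Ioo u 0, F y = F z := fun y hy =>
    isOpen_Ioo.is_const_of_deriv_eq_zero isPreconnected_Ioo
      (fun x hx => (hder x hx).differentiableAt.differentiableWithinAt)
      (fun x hx => (hder x hx).deriv) hy hz
  have hlim : Tendsto F (𝓝[<] 0) (𝓝 (a ^ 2)) := by
    have := ((h.tendsto'.pow 2).sub ((h.tendsto.pow 2).const_mul β)).sub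
      ((h.tendsto.pow 4).div_const 4)
    convert! this using 2
    ring
  have hlim' : Tendsto F (𝓝[<] 0) (𝓝 (F z)) := by
    refine tendsto_const_nhds.congr' ?_
    filter_upwards [Ioo_mem_nhdsLT h.neg] with y hy using (hconst y hy).symm
  have := tendsto_nhds_unique hlim hlim'
  simp only [hF] at this
  linarith

/-- The operator with `(P ∘ T)'' = (odeOp P) ∘ T`. -/
noncomputable def odeOp (a β : ℝ) (P : ℝ[X]) : ℝ[X] :=
  derivative (derivative P) * (C (a ^ 2) + C β * X ^ 2 + C (1 / 4) * X ^ 4) +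
    derivative P * (C β * X + C (1 / 2) * X ^ 3)

theorem odeOp_add (a β : ℝ) (P Q : ℝ[X]) : odeOp a β (P + Q) = odeOp a β P + odeOp a β Q := by
  simp only [odeOp, derivative_add]; ring

theorem odeOp_C_mul (a β c : ℝ) (P : ℝ[X]) : odeOp a β (C c * P) = C c * odeOp a β P := by
  simp only [odeOp, derivative_C_mul]; ring

theorem odeOp_X_pow (a β : ℝ) (N : ℕ) : odeOp a β (X ^ N) =
    C ((N : ℝ) * (N - 1) * a ^ 2) * X ^ (N - 2) + C ((N : ℝ) ^ 2 * β) * X ^ N +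
      C ((N : ℝ) * (N + 1) / 4) * X ^ (N + 2) := by
  refine Polynomial.funext fun x => ?_
  rcases N with _ | _ | N
  · simp [odeOp]
  · simp [odeOp]; left; norm_num
  · simp [odeOp]; ring

/-- The lowering coefficients of `-(d/dz)²` on the powers `T^{2n+1+ε}`. -/
noncomputable def odeLower (ε : ℕ) (a : ℝ) (n : ℕ) : ℝ :=
  if n = 0 then 0 else -((2 * n + 1 + ε) * (2 * n + ε) * a ^ 2)

/-- The diagonal coefficients of `-(d/dz)²` on the powers `T^{2n+1+ε}`. -/
noncomputable def odeDiag (ε : ℕ) (β : ℝ) (n : ℕ) : ℝ := -((2 * n + 1 + ε) ^ 2 * β)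

/-- The raising coefficients of `-(d/dz)²` on the powers `T^{2n+1+ε}`. -/
noncomputable def odeRaise (ε : ℕ) (n : ℕ) : ℝ := -((2 * n + 1 + ε) * (2 * n + 2 + ε) / 4)

/-- The tridiagonal operator representing `-(d/dz)²` on the powers `T^{2n+1+ε}`. -/
noncomputable def odeJacobi (ε : ℕ) (a β : ℝ) : Module.End ℝ ℝ[X] :=
  jacobiOp (odeLower ε a) (odeDiag ε β) (odeRaise ε)

/-- For ε = 1 the second derivative of T² contains the constant 2a², which lies outside the span of
T², T⁴, …. It is split off here, in accordance with the value 0 of `odeLower` at n = 0. -/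
theorem odeOp_expand {ε : ℕ} (hε : ε ≤ 1) (a β : ℝ) (Q : ℝ[X]) :
    odeOp a β (X ^ (1 + ε) * expand ℝ 2 Q) =
      -(X ^ (1 + ε) * expand ℝ 2 (odeJacobi ε a β Q)) + C (ε * (2 * a ^ 2) * Q.coeff 0) := by
  induction Q using Polynomial.induction_on' with
  | add P Q hP hQ =>
    simp only [map_add, mul_add, odeOp_add, hP, hQ, coeff_add]; ring
  | monomial n c =>
    rw [← C_mul_X_pow_eq_monomial]
    have h1 : odeJacobi ε a β (C c * X ^ n) = C c * odeJacobi ε a β (X ^ n) := by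
      rw [← smul_eq_C_mul, map_smul, smul_eq_C_mul]
    have h2 : X ^ (1 + ε) * expand ℝ 2 (C c * X ^ n) = C c * X ^ (2 * n + 1 + ε) := by
      rw [map_mul, expand_C, map_pow, expand_X]; ring
    rw [h1, h2, odeOp_C_mul, odeOp_X_pow, odeJacobi, jacobiOp_X_pow]
    refine Polynomial.funext fun x => ?_
    rcases n with _ | n
    · interval_cases ε
      · simp [odeLower, odeDiag, odeRaise]; ring
      · simp [odeLower, odeDiag, odeRaise]; ring
    · have e1 : 2 * (n + 1) + 1 + ε - 2 = 2 * n + 1 + ε := by omega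
      rw [e1]
      simp [odeLower, odeDiag, odeRaise]; ring

theorem IsOdeSolution.iteratedDeriv_eval {T T' : ℝ → ℝ} {u a β : ℝ}
    (h : IsOdeSolution T T' u a β) (P : ℝ[X]) {z : ℝ} (hz : z ∈ Set.Ioo u 0) :
    iteratedDeriv 1 (fun z => P.eval (T z)) z = (derivative P).eval (T z) * T' z ∧
    iteratedDeriv 2 (fun z => P.eval (T z)) z = (odeOp a β P).eval (T z) := by
  have h1 : ∀ y ∈ Set.Ioo u 0, ∀ Q : ℝ[X],
      HasDerivAt (fun z => Q.eval (T z)) ((derivative Q).eval (T y) * T' y) y := fun y hy Q =>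
    (Q.hasDerivAt (T y)).comp y (h.hasDerivAt y hy)
  have h2 : deriv (fun z => P.eval (T z)) =ᶠ[𝓝 z] fun z => (derivative P).eval (T z) * T' z := by
    filter_upwards [isOpen_Ioo.mem_nhds hz] with y hy using (h1 y hy P).deriv
  refine ⟨by rw [iteratedDeriv_one, h2.self_of_nhds], ?_⟩
  have h4 : HasDerivAt (fun z => (derivative P).eval (T z) * T' z) _ z :=
    (h1 z hz (derivative P)).mul (h.hasDerivAt' z hz)
  rw [iteratedDeriv_succ, iteratedDeriv_one, h2.deriv_eq, h4.deriv]
  have h3 := h.sq_eq hz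
  simp only [odeOp, eval_add, eval_mul, eval_C, eval_pow, eval_X]
  linear_combination (derivative (derivative P)).eval (T z) * h3

/-- At least one derivative remains after the first two, and it kills the constant split off in
`odeOp_expand`. -/
theorem IsOdeSolution.iteratedDeriv_expand {T T' : ℝ → ℝ} {u a β : ℝ}
    (h : IsOdeSolution T T' u a β) {ε : ℕ} (hε : ε ≤ 1) (Q : ℝ[X]) (k : ℕ) {z : ℝ}
    (hz : z ∈ Set.Ioo u 0) :
    iteratedDeriv (k + 1 + 2) (fun z => (X ^ (1 + ε) * expand ℝ 2 Q).eval (T z)) z =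
      -iteratedDeriv (k + 1) (fun z => (X ^ (1 + ε) * expand ℝ 2 (odeJacobi ε a β Q)).eval (T z))
        z := by
  have h1 : iteratedDeriv 2 (fun z => (X ^ (1 + ε) * expand ℝ 2 Q).eval (T z)) =ᶠ[𝓝 z]
      fun z => (ε * (2 * a ^ 2) * Q.coeff 0) +
        -(X ^ (1 + ε) * expand ℝ 2 (odeJacobi ε a β Q)).eval (T z) := by
    filter_upwards [isOpen_Ioo.mem_nhds hz] with y hy
    rw [(h.iteratedDeriv_eval _ hy).2, odeOp_expand hε, eval_add, eval_neg, eval_C]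
    ring
  rw [iteratedDeriv_succ', iteratedDeriv_succ']
  have h2 : deriv (deriv (fun z => (X ^ (1 + ε) * expand ℝ 2 Q).eval (T z))) =
      iteratedDeriv 2 (fun z => (X ^ (1 + ε) * expand ℝ 2 Q).eval (T z)) := by
    rw [iteratedDeriv_succ, iteratedDeriv_one]
  rw [h2, h1.iteratedDeriv_eq, iteratedDeriv_const_add (Nat.succ_pos k), iteratedDeriv_fun_neg]

theorem IsOdeSolution.iteratedDeriv_expand_pow {T T' : ℝ → ℝ} {u a β : ℝ}
    (h : IsOdeSolution T T' u a β) {ε : ℕ} (hε : ε ≤ 1) (Q : ℝ[X]) (k j : ℕ) {z : ℝ}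
    (hz : z ∈ Set.Ioo u 0) :
    iteratedDeriv (k + 1 + 2 * j) (fun z => (X ^ (1 + ε) * expand ℝ 2 Q).eval (T z)) z =
      (-1) ^ j * iteratedDeriv (k + 1)
        (fun z => (X ^ (1 + ε) * expand ℝ 2 ((odeJacobi ε a β ^ j) Q)).eval (T z)) z := by
  induction j generalizing Q with
  | zero => simp
  | succ j ih =>
    rw [show k + 1 + 2 * (j + 1) = (k + 2 * j) + 1 + 2 by ring, h.iteratedDeriv_expand hε _ _ hz,
      show k + 2 * j + 1 = k + 1 + 2 * j by ring, ih, pow_succ (odeJacobi ε a β),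
      Module.End.mul_apply, pow_succ]
    ring

/-- The moment functional attached to a solution of the differential equation. -/
noncomputable def odeFunctional (ε : ℕ) (a β : ℝ) : ℝ[X] →ₗ[ℝ] ℝ :=
  jacobiFunctional (odeLower ε a) (odeDiag ε β) (odeRaise ε) (a ^ (1 + ε))

/-- Trading pairs of derivatives for powers of the tridiagonal operator leaves the derivative of
order 1 + ε of T^{1+ε} Q(T²). As T → 0 and T' → a, only Q(0) survives, with factor (1+ε)! a^{1+ε},
and (1+ε)! = 1 + ε because ε ≤ 1. -/
theorem IsOdeSolution.odeFunctional_X_pow {T T' : ℝ → ℝ} {u a β : ℝ}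
    (h : IsOdeSolution T T' u a β) {ε : ℕ} (hε : ε ≤ 1) (j : ℕ) {M : ℝ}
    (hM : Tendsto (fun z => iteratedDeriv (2 * j + 1 + ε) (fun z => T z ^ (1 + ε)) z) (𝓝[<] 0)
      (𝓝 M)) :
    odeFunctional ε a β (X ^ j) = (-1) ^ j * (M / (1 + ε)) := by
  set Q := (odeJacobi ε a β ^ j) 1 with hQ
  have hval : odeFunctional ε a β (X ^ j) = a ^ (1 + ε) * Q.coeff 0 := by
    rw [odeFunctional, jacobiFunctional_apply, map_pow, aeval_X]; rfl
  have hlim : Tendsto (fun z => iteratedDeriv (1 + ε)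
      (fun z => (X ^ (1 + ε) * expand ℝ 2 Q).eval (T z)) z) (𝓝[<] 0)
      (𝓝 ((1 + ε) * (a ^ (1 + ε) * Q.coeff 0))) := by
    have hmem : ∀ᶠ z in 𝓝[<] (0 : ℝ), z ∈ Set.Ioo u 0 := Ioo_mem_nhdsLT h.neg
    have hpoly : ∀ P : ℝ[X], Tendsto (fun z => P.eval (T z)) (𝓝[<] 0) (𝓝 (P.eval 0)) := fun P =>
      (P.continuous.tendsto 0).comp h.tendsto
    interval_cases ε
    · refine Tendsto.congr' (hmem.mono fun z hz => (h.iteratedDeriv_eval _ hz).1.symm) ?_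
      have := (hpoly (derivative (X ^ (1 + 0) * expand ℝ 2 Q))).mul h.tendsto'
      convert! this using 2
      simp [derivative_mul, expand_eval, coeff_zero_eq_eval_zero]
      ring
    · refine Tendsto.congr' (hmem.mono fun z hz => (h.iteratedDeriv_eval _ hz).2.symm) ?_
      have := hpoly (odeOp a β (X ^ (1 + 1) * expand ℝ 2 Q))
      convert! this using 2
      rw [odeOp_expand le_rfl]
      simp
      ring
  have hM' : Tendsto (fun z => iteratedDeriv (1 + ε)
      (fun z => (X ^ (1 + ε) * expand ℝ 2 Q).eval (T z)) z) (𝓝[<] 0) (𝓝 ((-1) ^ j * M)) := by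
    refine (hM.const_mul ((-1) ^ j)).congr' ?_
    filter_upwards [Ioo_mem_nhdsLT h.neg] with z hz
    have h1 := h.iteratedDeriv_expand_pow hε 1 ε j hz
    rw [← hQ] at h1
    have h2 : (fun z => (X ^ (1 + ε) * expand ℝ 2 (1 : ℝ[X])).eval (T z)) =
        fun z => T z ^ (1 + ε) := by
      funext z; simp
    rw [h2] at h1
    rw [show 2 * j + 1 + ε = ε + 1 + 2 * j by ring, h1, ← mul_assoc, ← mul_pow,
      add_comm ε 1]
    norm_num
  have h3 := tendsto_nhds_unique hlim hM'
  have h4 : (1 + (ε : ℝ)) ≠ 0 := by positivity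
  rw [hval, ← mul_right_inj' h4, h3]
  field_simp

/-! ### Hankel determinants -/

theorem odeFunctional_orthogonal (ε : ℕ) (a β : ℝ) (i j : ℕ) (h : i ≠ j) :
    odeFunctional ε a β (jacobiPoly (odeLower ε a) (odeDiag ε β) (odeRaise ε) i *
      jacobiPoly (odeLower ε a) (odeDiag ε β) (odeRaise ε) j) = 0 :=
  jacobiFunctional_orthogonal (by simp [odeLower]) i j h

/-- Each product of a lowering and a raising coefficient carries exactly one factor a², and the
diagonal, the only place where β occurs, does not enter the norms. -/
theorem odeFunctional_sq (ε : ℕ) (a β : ℝ) (n : ℕ) :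
    odeFunctional ε a β (jacobiPoly (odeLower ε a) (odeDiag ε β) (odeRaise ε) n ^ 2) =
      a ^ (1 + ε + 2 * n) * ∏ i ∈ Finset.range n, -(odeLower ε 1 (i + 1)) * -(odeRaise ε i) := by
  rw [odeFunctional, jacobiFunctional_sq (by simp [odeLower]), pow_add a (1 + ε), pow_mul, mul_assoc]
  congr 1
  rw [← Finset.card_range n, ← Finset.prod_const, Finset.card_range, ← Finset.prod_mul_distrib]
  refine Finset.prod_congr rfl fun i _ => ?_
  rw [odeLower, odeLower, if_neg (Nat.succ_ne_zero i), if_neg (Nat.succ_ne_zero i)]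
  ring

theorem odeFunctional_sq_pos (ε : ℕ) (a β : ℝ) (ha : 0 < a) (n : ℕ) :
    0 < odeFunctional ε a β (jacobiPoly (odeLower ε a) (odeDiag ε β) (odeRaise ε) n ^ 2) := by
  rw [odeFunctional_sq]
  refine mul_pos (pow_pos ha _) (Finset.prod_pos fun i _ => mul_pos ?_ ?_)
  · rw [odeLower, if_neg (Nat.succ_ne_zero i), neg_neg]; positivity
  · rw [odeRaise, neg_neg]; positivity

/-- The universal constants cancel factor by factor, and the exponents 1 + ε + 2i for i < m add up
to m(m + ε). -/
theorem det_hankelMatrix_odeFunctional_div {μ : (ℝ → ℝ) → ℝ} {ε : ℕ} {a₀ β₀ : ℝ}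
    (hμ : ∀ Q : ℝ[X], μ (fun x => Q.eval x) = odeFunctional ε a₀ β₀ Q) (ha₀ : 0 < a₀)
    (a β : ℝ) (m : ℕ) :
    (∀ i, orthoNormSq μ i ≠ 0) ∧ (hankelMatrix (odeFunctional ε a β) m).det /
      ∏ i ∈ Finset.range m, orthoNormSq μ i = (a / a₀) ^ (m * (m + ε)) := by
  have hn : ∀ i, orthoNormSq μ i = odeFunctional ε a₀ β₀
      (jacobiPoly (odeLower ε a₀) (odeDiag ε β₀) (odeRaise ε) i ^ 2) := fun i =>
    orthoNormSq_eq hμ (isMonicSeq_jacobiPoly _ _ _) (odeFunctional_orthogonal ε a₀ β₀)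
      (fun i => (odeFunctional_sq_pos ε a₀ β₀ ha₀ i).ne') i
  have hne : ∀ i, orthoNormSq μ i ≠ 0 := fun i => by
    rw [hn]; exact (odeFunctional_sq_pos ε a₀ β₀ ha₀ i).ne'
  refine ⟨hne, ?_⟩
  rw [det_hankelMatrix (isMonicSeq_jacobiPoly _ _ _) (odeFunctional_orthogonal ε a β),
    ← Finset.prod_div_distrib]
  have h1 : ∀ i ∈ Finset.range m, odeFunctional ε a β
      (jacobiPoly (odeLower ε a) (odeDiag ε β) (odeRaise ε) i ^ 2) / orthoNormSq μ i =
      (a / a₀) ^ (1 + ε + 2 * i) := by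
    intro i _
    have h2 := hne i
    rw [hn, odeFunctional_sq] at h2 ⊢
    rw [odeFunctional_sq, mul_div_mul_right _ _ (right_ne_zero_of_mul h2), div_pow]
  rw [Finset.prod_congr rfl h1, Finset.prod_pow_eq_pow_sum]
  congr 1
  induction m with
  | zero => simp
  | succ m ih => rw [Finset.sum_range_succ, ih (fun i hi => h1 i
      (Finset.mem_range.2 ((Finset.mem_range.1 hi).trans (Nat.lt_succ_self m))))]; ring

/-! ### Abel means of `(-1)^{k-1} k^n` -/

theorem hasSum_stepCoeff_pow {n : ℕ} (hn : n ≠ 0) {z : ℝ} (hz : z < 0) :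
    HasSum (fun k : ℤ => ((k : ℝ) ^ n * ((-1) ^ k * stepCoeff k)) * Real.exp (k * z))
      (-iteratedDeriv n Real.sigmoid z) := by
  have hmem : z ∈ Set.Ioo (z - 1) 0 := ⟨by linarith, hz⟩
  have hs := expSummable_stepCoeff (z - 1)
  have h1 := (hs.pow_mul n).hasSum hmem
  have h2 : expSeries (fun k => (-1) ^ k * stepCoeff k) =ᶠ[𝓝 z]
      fun z => 1 / 2 + -Real.sigmoid z := by
    filter_upwards [Iio_mem_nhds hz] with y hy
    rw [expSeries_stepCoeff hy]; ring
  rw [← hs.iteratedDeriv_eq n hmem, h2.iteratedDeriv_eq,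
    iteratedDeriv_const_add (Nat.pos_of_ne_zero hn), iteratedDeriv_fun_neg] at h1
  exact h1

theorem hasSum_abel {n : ℕ} (hn : n ≠ 0) {z : ℝ} (hz : z < 0) :
    HasSum (fun k : ℕ => Real.exp z ^ (k + 1) * ((-1) ^ k * ((k : ℝ) + 1) ^ n))
      (iteratedDeriv n Real.sigmoid z) := by
  have h1 := (hasSum_stepCoeff_pow hn hz).neg
  rw [neg_neg] at h1
  have hinj : Function.Injective fun k : ℕ => (k : ℤ) + 1 := fun a b h => by
    simpa using h
  refine ((hinj.hasSum_iff fun k hk => ?_).2 h1).congr_of_eq (fun k => ?_) rfl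
  · have hk : k ≤ 0 := by
      by_contra h
      exact hk ⟨(k - 1).toNat, by simp only []; omega⟩
    rcases hk.eq_or_lt with rfl | hk
    · simp [hn]
    · rw [stepCoeff, if_pos hk]; ring
  · simp only [Function.comp_apply]
    rw [stepCoeff, if_neg (by omega), if_neg (by omega), ← Real.exp_nat_mul,
      zpow_add_one₀ (by norm_num), zpow_natCast]
    push_cast
    ring

theorem tendsto_iteratedDeriv_sigmoid (n : ℕ) :
    Tendsto (iteratedDeriv n Real.sigmoid) (𝓝[<] 0) (𝓝 (iteratedDeriv n Real.sigmoid 0)) := by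
  have h : Continuous (iteratedDeriv n Real.sigmoid) :=
    contDiff_sigmoid.continuous_iteratedDeriv n (by exact_mod_cast le_top)
  exact (h.tendsto 0).mono_left nhdsWithin_le_nhds

theorem tendsto_log_nhdsLT_one : Tendsto Real.log (𝓝[<] 1) (𝓝[<] 0) := by
  refine tendsto_nhdsWithin_iff.2 ⟨?_, ?_⟩
  · have := (Real.continuousAt_log one_ne_zero).tendsto
    rw [Real.log_one] at this
    exact this.mono_left nhdsWithin_le_nhds
  · filter_upwards [Ioo_mem_nhdsLT (zero_lt_one' ℝ)] with t ht using Real.log_neg ht.1 ht.2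

/-- With t = e^z the Abel limit t → 1- becomes z → 0-. For z < 0 the series of (-1)^{k-1} k^n e^{kz}
is the n-th derivative of the sigmoid, which is smooth at 0. -/
theorem momentFunctional_eval (ε : ℕ) (Q : ℝ[X]) :
    momentFunctional ε (fun x => Q.eval x) = Q.sum fun j c =>
      c * ((-1) ^ j * (2 * (-1) ^ ε * iteratedDeriv (2 * j + 1 + 2 * ε) Real.sigmoid 0)) := by
  have hsum : ∀ t ∈ Set.Ioo (0 : ℝ) 1, HasSum (fun k : ℕ => t ^ (k + 1) *
      ((-1) ^ (k + 1 + 1 + ε) * (((k + 1 : ℕ) : ℝ)) ^ (1 + 2 * ε) *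
        Q.eval (-(((k + 1 : ℕ) : ℝ)) ^ 2)))
      (∑ j ∈ Q.support, Q.coeff j * ((-1) ^ j * ((-1) ^ ε *
        iteratedDeriv (2 * j + 1 + 2 * ε) Real.sigmoid (Real.log t)))) := by
    intro t ht
    have h1 : ∀ j ∈ Q.support, HasSum (fun k : ℕ => Q.coeff j * ((-1) ^ j * ((-1) ^ ε *
        (t ^ (k + 1) * ((-1) ^ k * ((k : ℝ) + 1) ^ (2 * j + 1 + 2 * ε))))))
        (Q.coeff j * ((-1) ^ j * ((-1) ^ ε *
        iteratedDeriv (2 * j + 1 + 2 * ε) Real.sigmoid (Real.log t)))) := by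
      intro j _
      have h2 := hasSum_abel (n := 2 * j + 1 + 2 * ε) (by omega) (Real.log_neg ht.1 ht.2)
      rw [Real.exp_log ht.1] at h2
      exact ((h2.mul_left _).mul_left _).mul_left _
    refine (hasSum_sum h1).congr_of_eq (fun k => ?_) rfl
    rw [Polynomial.eval_eq_sum, Polynomial.sum, Finset.mul_sum, Finset.mul_sum]
    refine Finset.sum_congr rfl fun j _ => ?_
    rw [neg_pow (((k + 1 : ℕ) : ℝ) ^ 2), ← pow_mul]
    push_cast
    ring
  have hlim : Tendsto (fun t : ℝ => ∑' k : ℕ, t ^ (k + 1) *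
      ((-1) ^ (k + 1 + 1 + ε) * (((k + 1 : ℕ) : ℝ)) ^ (1 + 2 * ε) *
        Q.eval (-(((k + 1 : ℕ) : ℝ)) ^ 2))) (𝓝[<] 1)
      (𝓝 (∑ j ∈ Q.support, Q.coeff j * ((-1) ^ j * ((-1) ^ ε *
        iteratedDeriv (2 * j + 1 + 2 * ε) Real.sigmoid 0)))) := by
    have h1 : Tendsto (fun t : ℝ => ∑ j ∈ Q.support, Q.coeff j * ((-1) ^ j * ((-1) ^ ε *
        iteratedDeriv (2 * j + 1 + 2 * ε) Real.sigmoid (Real.log t)))) (𝓝[<] 1)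
        (𝓝 (∑ j ∈ Q.support, Q.coeff j * ((-1) ^ j * ((-1) ^ ε *
        iteratedDeriv (2 * j + 1 + 2 * ε) Real.sigmoid 0)))) :=
      tendsto_finsetSum _ fun j _ =>
        ((((tendsto_iteratedDeriv_sigmoid _).comp tendsto_log_nhdsLT_one).const_mul _).const_mul
          _).const_mul _
    refine h1.congr' ?_
    filter_upwards [Ioo_mem_nhdsLT (zero_lt_one' ℝ)] with t ht using (hsum t ht).tsum_eq.symm
  rw [momentFunctional, abelSum, hlim.limUnder_eq, Polynomial.sum, Finset.mul_sum]
  exact Finset.sum_congr rfl fun j _ => by ring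

/-! ### The moment functional as a functional attached to `tanh (z / 2)` -/

/-- For y = tanh(z/2) one has y' = (1 - y²)/2 and hence y'' = -y/2 + y³/2. The left endpoint -1 is
arbitrary. -/
theorem isOdeSolution_sigmoid : IsOdeSolution (fun z => 2 * Real.sigmoid z - 1)
    (fun z => 2 * (Real.sigmoid z * (1 - Real.sigmoid z))) (-1) (1 / 2) (-1 / 2) where
  neg := by norm_num
  hasDerivAt z _ := ((Real.hasDerivAt_sigmoid z).const_mul 2).sub_const 1
  hasDerivAt' z _ := by
    have h := Real.hasDerivAt_sigmoid z
    have h1 := (h.mul (h.const_sub 1)).const_mul 2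
    convert! h1 using 1
    ring
  tendsto := by
    have h : Tendsto Real.sigmoid (𝓝[<] 0) (𝓝 2⁻¹) := by
      rw [← Real.sigmoid_zero]
      exact (continuous_sigmoid.tendsto 0).mono_left nhdsWithin_le_nhds
    have := (h.const_mul 2).sub_const 1
    norm_num at this
    exact this
  tendsto' := by
    have h : Tendsto Real.sigmoid (𝓝[<] 0) (𝓝 2⁻¹) := by
      rw [← Real.sigmoid_zero]
      exact (continuous_sigmoid.tendsto 0).mono_left nhdsWithin_le_nhds
    have := (h.mul (h.const_sub 1)).const_mul 2
    norm_num at this ⊢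
    exact this

theorem odeFunctional_half_X_pow {ε : ℕ} (hε : ε ≤ 1) (j : ℕ) :
    odeFunctional ε (1 / 2) (-1 / 2) (X ^ j) =
      (-1) ^ j * (2 * (-1) ^ ε * iteratedDeriv (2 * j + 1 + 2 * ε) Real.sigmoid 0) := by
  interval_cases ε
  · have h := isOdeSolution_sigmoid.odeFunctional_X_pow (ε := 0) (by norm_num) j
      (M := 2 * iteratedDeriv (2 * j + 1) Real.sigmoid 0) (by
        refine ((tendsto_iteratedDeriv_sigmoid _).const_mul 2).congr fun z => ?_
        have h1 : (fun z => (2 * Real.sigmoid z - 1) ^ (1 + 0)) =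
            fun z => -1 + 2 * Real.sigmoid z := by funext z; ring
        rw [h1, iteratedDeriv_const_add (by omega), iteratedDeriv_const_mul_field])
    rw [h]; simp
  · have h := isOdeSolution_sigmoid.odeFunctional_X_pow (ε := 1) le_rfl j
      (M := -4 * iteratedDeriv (2 * j + 3) Real.sigmoid 0) (by
        refine ((tendsto_iteratedDeriv_sigmoid _).const_mul (-4)).congr fun z => ?_
        -- The identity tanh²(z/2) = 1 - 4σ'(z) raises the order of differentiation by one.
        have h1 : (fun z => (2 * Real.sigmoid z - 1) ^ (1 + 1)) =
            fun z => 1 + (-4) * deriv Real.sigmoid z := by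
          funext z; rw [Real.deriv_sigmoid]; ring
        rw [h1, iteratedDeriv_const_add (by omega), iteratedDeriv_const_mul_field,
          ← iteratedDeriv_succ'])
    rw [h, show 2 * j + 1 + 2 * 1 = 2 * j + 3 by ring]
    norm_num
    ring

theorem momentFunctional_eq_odeFunctional {ε : ℕ} (hε : ε ≤ 1) (Q : ℝ[X]) :
    momentFunctional ε (fun x => Q.eval x) = odeFunctional ε (1 / 2) (-1 / 2) Q := by
  rw [momentFunctional_eval]
  conv_rhs => rw [Q.as_sum_support_C_mul_X_pow]
  rw [map_sum, Polynomial.sum]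
  refine Finset.sum_congr rfl fun j _ => ?_
  rw [← smul_eq_C_mul, map_smul, smul_eq_mul, odeFunctional_half_X_pow hε]

/-! ### The functional attached to the Lambert series -/

section Lambert

variable {p : ℝ}

/-- The value at `0-` of the derivative of `-2 L`. -/
noncomputable def lambertSlope (p : ℝ) : ℝ :=
  1 / 2 - 2 * ∑' k : ℤ, (k : ℝ) * ((-1) ^ k * (lambertCoeff p k - stepCoeff k))

/-- The step part, divergent at z = 0, sums to a derivative of the sigmoid for z < 0 and so has a
limit; the remainder r converges on both sides of 0. -/
theorem tendsto_expSeries_nhdsLT {c r : ℤ → ℝ} {u : ℝ} (hu : u < 0) {n : ℕ} (hn : n ≠ 0)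
    (hr : ExpSummable r u (-u))
    (hc : ∀ k : ℤ, c k = (k : ℝ) ^ n * ((-1) ^ k * stepCoeff k) + r k) :
    Tendsto (expSeries c) (𝓝[<] 0) (𝓝 (-iteratedDeriv n Real.sigmoid 0 + ∑' k, r k)) := by
  have h1 : Tendsto (expSeries r) (𝓝[<] 0) (𝓝 (∑' k, r k)) := by
    rw [← expSeries_zero]
    exact (hr.continuousAt ⟨hu, by linarith⟩).tendsto.mono_left nhdsWithin_le_nhds
  refine ((tendsto_iteratedDeriv_sigmoid n).neg.add h1).congr' ?_
  filter_upwards [Ioo_mem_nhdsLT hu] with z hz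
  symm
  refine HasSum.tsum_eq (((hasSum_stepCoeff_pow hn hz.2).add
    (hr.hasSum ⟨hz.1, by linarith [hz.2]⟩)).congr_of_eq (fun k => ?_) rfl)
  rw [hc]; ring

theorem tendsto_expSeries_lambertCoeff (hp0 : p ≠ 0) (hp1 : |p| < 1) {n : ℕ} (hn : n ≠ 0) :
    Tendsto (expSeries fun k => (k : ℝ) ^ n * ((-1) ^ k * lambertCoeff p k)) (𝓝[<] 0)
      (𝓝 (-iteratedDeriv n Real.sigmoid 0 +
        ∑' k : ℤ, (k : ℝ) ^ n * ((-1) ^ k * (lambertCoeff p k - stepCoeff k)))) :=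
  tendsto_expSeries_nhdsLT (log_abs_neg hp0 hp1) hn
    ((expSummable_lambertCoeff_sub_stepCoeff hp0 hp1).pow_mul n) fun k => by ring

theorem exists_isOdeSolution_lambertL (hp0 : p ≠ 0) (hp1 : |p| < 1) :
    ∃ β, IsOdeSolution (fun z => -2 * lambertL p z)
      (fun z => -2 * expSeries (fun k => (k : ℝ) * ((-1) ^ k * lambertCoeff p k)) z)
      (Real.log |p|) (lambertSlope p) β := by
  obtain ⟨C, hC⟩ := exists_lambertL_ode hp0 hp1
  have hL := expSummable_lambertCoeff hp0 hp1
  have hlog := log_abs_neg hp0 hp1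
  -- For T = -2L, the equation L'' = 2L³ - 2CL reads T'' = -2C T + T³/2.
  refine ⟨-2 * C, hlog, fun z hz => (hL.hasDerivAt hz).const_mul (-2), fun z hz => ?_, ?_, ?_⟩
  · have h1 := (hL.intCast_mul.hasDerivAt hz).const_mul (-2)
    convert! h1 using 1
    have h2 := hC z hz
    simp only [pow_two, mul_assoc] at h2
    rw [h2]; ring
  · have h1 : Tendsto (fun z => -2 * (1 / 2 - Real.sigmoid z + lambertReg p z)) (𝓝[<] 0)
        (𝓝 (-2 * (1 / 2 - Real.sigmoid 0 + lambertReg p 0))) :=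
      ((((continuous_sigmoid.tendsto 0).const_sub (1 / 2)).add
        (hasDerivAt_lambertReg hp0 hp1).continuousAt.tendsto).const_mul (-2)).mono_left
          nhdsWithin_le_nhds
    rw [lambertReg_zero hp0 hp1, Real.sigmoid_zero] at h1
    norm_num at h1
    refine h1.congr' ?_
    filter_upwards [Ioo_mem_nhdsLT hlog] with z hz
    rw [lambertL_eq hp0 hp1 hz]; norm_num
  · have h1 := (tendsto_expSeries_lambertCoeff hp0 hp1 one_ne_zero).const_mul (-2)
    simp only [pow_one, iteratedDeriv_one, Real.deriv_sigmoid, Real.sigmoid_zero] at h1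
    convert! h1 using 2
    rw [lambertSlope]; ring

/-- The regular part of the coefficients of the square of the Lambert series. -/
noncomputable def lambertSqReg (p : ℝ) (n : ℤ) : ℝ :=
  if n = 0 then 0 else 1 / (1 - p ^ n) - stepCoeff n

theorem lambertSqReg_neg (hp0 : p ≠ 0) (hp1 : |p| < 1) (n : ℤ) :
    lambertSqReg p (-n) = -lambertSqReg p n := by
  unfold lambertSqReg
  by_cases hn : n = 0
  · simp [hn]
  · rw [if_neg hn, if_neg (neg_ne_zero.2 hn), stepCoeff_neg]
    have h1 := one_sub_zpow_ne_zero hp0 hp1 hn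
    have h2 := one_sub_zpow_ne_zero hp0 hp1 (neg_ne_zero.2 hn)
    have h3 : p ^ n ≠ 0 := zpow_ne_zero _ hp0
    have h4 : 1 / (1 - p ^ (-n)) = 1 - 1 / (1 - p ^ n) := by
      rw [eq_sub_iff_add_eq, div_add_div _ _ h2 h1, div_eq_one_iff_eq (mul_ne_zero h2 h1), zpow_neg]
      field_simp
      ring
    rw [h4]; ring

theorem lambertSqReg_natCast_succ (hp0 : p ≠ 0) (hp1 : |p| < 1) (k : ℕ) :
    lambertSqReg p ((k + 1 : ℕ) : ℤ) = p ^ (k + 1) / (1 - p ^ (k + 1)) := by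
  have h1 := one_sub_zpow_ne_zero hp0 hp1 (n := ((k + 1 : ℕ) : ℤ)) (by omega)
  rw [zpow_natCast] at h1
  rw [lambertSqReg, stepCoeff, if_neg (by omega), if_neg (by omega), if_neg (by omega),
    zpow_natCast]
  field_simp
  ring

theorem expSummable_lambertSqReg (hp0 : p ≠ 0) (hp1 : |p| < 1) :
    ExpSummable (fun k => (-1) ^ k * lambertSqReg p k) (Real.log |p|) (-Real.log |p|) := by
  have hpos : 0 < 1 - |p| := by linarith
  have hnat : ∀ k : ℕ, |lambertSqReg p (k : ℤ)| ≤ (1 - |p|)⁻¹ * |p| ^ k := by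
    intro k
    rcases k with _ | k
    · simp [lambertSqReg]; exact hp1.le
    · rw [lambertSqReg_natCast_succ hp0 hp1, abs_div, abs_pow, div_eq_inv_mul]
      refine mul_le_mul_of_nonneg_right ?_ (by positivity)
      refine inv_anti₀ hpos ?_
      have h1 : |p| ^ (k + 1) ≤ |p| := by
        simpa using pow_le_of_le_one (abs_nonneg p) hp1.le (Nat.succ_ne_zero k)
      have h2 := le_abs_self (p ^ (k + 1))
      rw [abs_pow] at h2
      exact le_trans (by linarith) (le_abs_self _)
  refine expSummable_of_abs_le (abs_pos.2 hp0) (C := (1 - |p|)⁻¹) fun k => ?_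
  rw [abs_mul, abs_zpow, abs_neg, abs_one, one_zpow, one_mul]
  obtain ⟨n, rfl | rfl⟩ := k.eq_nat_or_neg
  · simpa using hnat n
  · rw [lambertSqReg_neg hp0 hp1, abs_neg]
    simpa using hnat n

/-- The coefficient k / (1 - p^k) supplies one extra power of k, and the factor k^n removes the
unevaluated constant coefficient. -/
theorem tendsto_expSeries_lambertSqCoeff (hp0 : p ≠ 0) (hp1 : |p| < 1) {n : ℕ} (hn : n ≠ 0) :
    Tendsto (expSeries fun k => (k : ℝ) ^ n * ((-1) ^ k * lambertSqCoeff p k)) (𝓝[<] 0)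
      (𝓝 (-iteratedDeriv (n + 1) Real.sigmoid 0 +
        ∑' k : ℤ, (k : ℝ) ^ (n + 1) * ((-1) ^ k * lambertSqReg p k))) := by
  refine tendsto_expSeries_nhdsLT (log_abs_neg hp0 hp1) (Nat.succ_ne_zero n)
    ((expSummable_lambertSqReg hp0 hp1).pow_mul (n + 1)) fun k => ?_
  by_cases hk : k = 0
  · subst hk; simp [hn]
  · rw [lambertSqCoeff, lambertSqReg, if_neg hk, if_neg hk]; ring

theorem hasSum_nat_of_even {f : ℤ → ℝ} (hf : Summable f) (h0 : f 0 = 0)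
    (heven : ∀ k, f (-k) = f k) : HasSum (fun k : ℕ => f k) ((∑' k, f k) / 2) := by
  have h1 := (hf.hasSum.nat_add_neg).div_const 2
  refine h1.congr_of_eq (fun k => ?_) (by rw [h0, add_zero])
  rw [heven]; ring

theorem neg_one_zpow_neg (k : ℤ) : (-1 : ℝ) ^ (-k) = (-1) ^ k := by
  rcases Int.even_or_odd k with h | h
  · rw [h.neg_one_zpow, h.neg.neg_one_zpow]
  · rw [h.neg_one_zpow, h.neg.neg_one_zpow]

theorem ExpSummable.summable {c : ℤ → ℝ} {u v : ℝ} (h : ExpSummable c u v) (hu : u < 0)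
    (hv : 0 < v) : Summable c := by
  simpa using h 0 ⟨hu, hv⟩

/-! ### The weights as differences of moments -/

theorem hasSum_weight_zero {q : ℝ} (hq0 : 0 < q) (hq1 : q < 1) {β : ℝ} {T' : ℝ → ℝ} {u : ℝ}
    (hode : IsOdeSolution (fun z => -2 * lambertL (-q) z) T' u (lambertSlope (-q)) β) (j : ℕ) :
    HasSum (fun k : ℕ => q ^ k * (k : ℝ) / (1 + (-q) ^ k) * (-(k : ℝ) ^ 2) ^ j)
      ((odeFunctional 0 (lambertSlope (-q)) β (X ^ j) -
        odeFunctional 0 (1 / 2) (-1 / 2) (X ^ j)) / 4) := by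
  have hn0 : -q ≠ 0 := by simpa using hq0.ne'
  have habs : |(-q)| < 1 := by rwa [abs_neg, abs_of_pos hq0]
  have hlog := log_abs_neg hn0 habs
  set S := ∑' k : ℤ, (k : ℝ) ^ (2 * j + 1) * ((-1) ^ k * (lambertCoeff (-q) k - stepCoeff k))
    with hS
  have h1 := hode.odeFunctional_X_pow (ε := 0) (by norm_num) j
    (M := -2 * (-iteratedDeriv (2 * j + 1) Real.sigmoid 0 + S)) (by
      refine ((tendsto_expSeries_lambertCoeff hn0 habs (n := 2 * j + 1) (by omega)).const_mul
        (-2)).congr' ?_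
      filter_upwards [Ioo_mem_nhdsLT hlog] with z hz
      simp only [add_zero, pow_one]
      rw [iteratedDeriv_const_mul_field, lambertL,
        (expSummable_lambertCoeff hn0 habs).iteratedDeriv_eq _ hz])
  have h2 := hasSum_nat_of_even (((expSummable_lambertCoeff_sub_stepCoeff hn0 habs).pow_mul
    (2 * j + 1)).summable hlog (by linarith)) (by simp) (fun k => by
      rw [neg_one_zpow_neg, lambertCoeff_neg hn0 habs, stepCoeff_neg]
      push_cast
      rw [Odd.neg_pow ⟨j, rfl⟩]; ring)
  rw [← hS] at h2
  -- The sigmoid parts of the two moments cancel. The factor 4 is 2 from T = -2L times 2 from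
  -- folding an even sum over the integers, and (-1)^k (-q)^k = q^k gives the stated weight.
  refine (h2.mul_left (-(-1) ^ j)).congr_of_eq (fun k => ?_) ?_
  · rcases k with _ | k
    · simp
    · rw [lambertCoeff_sub_stepCoeff_natCast_succ hn0 habs]
      rw [zpow_natCast, neg_pow (((k + 1 : ℕ) : ℝ) ^ 2), Int.cast_natCast]
      have h3 : q ^ (k + 1) = (-1) ^ (k + 1) * (-q) ^ (k + 1) := by rw [← mul_pow]; norm_num
      rw [h3]
      ring
  · rw [h1, odeFunctional_half_X_pow (by norm_num)]
    simp
    ring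

theorem hasSum_weight_one {q : ℝ} (hq0 : 0 < q) (hq1 : q < 1) {β : ℝ} {T' : ℝ → ℝ} {u : ℝ}
    (hode : IsOdeSolution (fun z => -2 * lambertL (-q) z) T' u (lambertSlope (-q)) β) (j : ℕ) :
    HasSum (fun k : ℕ => q ^ k * (k : ℝ) ^ 3 / (1 - (-q) ^ k) * (-(k : ℝ) ^ 2) ^ j)
      ((odeFunctional 1 (lambertSlope (-q)) β (X ^ j) -
        odeFunctional 1 (1 / 2) (-1 / 2) (X ^ j)) / 4) := by
  have hn0 : -q ≠ 0 := by simpa using hq0.ne'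
  have habs : |(-q)| < 1 := by rwa [abs_neg, abs_of_pos hq0]
  have hlog := log_abs_neg hn0 habs
  set S := ∑' k : ℤ, (k : ℝ) ^ (2 * j + 2 + 1) * ((-1) ^ k * lambertSqReg (-q) k) with hS
  have h1 := hode.odeFunctional_X_pow (ε := 1) le_rfl j
    (M := 4 * (-iteratedDeriv (2 * j + 2 + 1) Real.sigmoid 0 + S)) (by
      refine ((tendsto_expSeries_lambertSqCoeff hn0 habs (n := 2 * j + 2) (by omega)).const_mul
        4).congr' ?_
      filter_upwards [Ioo_mem_nhdsLT hlog] with z hz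
      have h2 : (fun z => (-2 * lambertL (-q) z) ^ (1 + 1)) =ᶠ[𝓝 z]
          fun z => 4 * expSeries (fun n => (-1) ^ n * lambertSqCoeff (-q) n) z := by
        filter_upwards [isOpen_Ioo.mem_nhds hz] with y hy
        rw [← lambertL_sq hn0 habs hy]; ring
      rw [h2.iteratedDeriv_eq, iteratedDeriv_const_mul_field,
        (expSummable_lambertSqCoeff hn0 habs).iteratedDeriv_eq _ hz])
  have h2 := hasSum_nat_of_even (((expSummable_lambertSqReg hn0 habs).pow_mul
    (2 * j + 2 + 1)).summable hlog (by linarith)) (by simp) (fun k => by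
      rw [neg_one_zpow_neg, lambertSqReg_neg hn0 habs]
      push_cast
      rw [Odd.neg_pow ⟨j + 1, by ring⟩]; ring)
  rw [← hS] at h2
  -- Here T² = 4L² and the normalization 1 + ε = 2 leave a factor 2, and folding the even sum
  -- doubles it to 4.
  refine (h2.mul_left ((-1) ^ j)).congr_of_eq (fun k => ?_) ?_
  · rcases k with _ | k
    · simp
    · rw [lambertSqReg_natCast_succ hn0 habs]
      rw [zpow_natCast, neg_pow (((k + 1 : ℕ) : ℝ) ^ 2), Int.cast_natCast]
      have h3 : q ^ (k + 1) = (-1) ^ (k + 1) * (-q) ^ (k + 1) := by rw [← mul_pow]; norm_num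
      rw [h3]
      ring
  · rw [h1, odeFunctional_half_X_pow le_rfl]
    norm_num
    ring

end Lambert

/-! ### Assembly of the two identities -/

theorem squareSeries_eq_thetaSq (q : ℝ) : squareSeries q = thetaSq q := by
  refine tsum_congr fun k => ?_
  rw [← zpow_natCast]
  congr 1
  push_cast
  rw [sq_abs]

theorem lambertSlope_neg {q : ℝ} (hq0 : 0 < q) (hq1 : q < 1) :
    lambertSlope (-q) = squareSeries q ^ 4 / 2 := by
  rw [lambertSlope, lambert_deriv_eq hq0 hq1, squareSeries_eq_thetaSq]

theorem neg_natCast_sq_injective : Function.Injective fun k : ℕ => -(k : ℝ) ^ 2 := by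
  intro a b h
  have h1 : (a : ℝ) ^ 2 = (b : ℝ) ^ 2 := neg_injective h
  have h2 : a ^ 2 = b ^ 2 := by exact_mod_cast h1
  exact Nat.pow_left_injective two_ne_zero h2

/-- The discrete functional is a quarter of the difference of the Lambert and tanh functionals, so
adding 4 times it to the latter gives the former. The determinant ratio is a power of a / (1/2) =
□(q)⁴. -/
theorem squareSeries_expansion {q : ℝ} (hq0 : 0 < q) (hq1 : q < 1) {ε : ℕ} (hε : ε ≤ 1) {β : ℝ}
    {w : ℕ → ℝ} (hw : w 0 = 0)
    (hsum : ∀ j, HasSum (fun k : ℕ => w k * (-(k : ℝ) ^ 2) ^ j)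
      ((odeFunctional ε (lambertSlope (-q)) β (X ^ j) -
        odeFunctional ε (1 / 2) (-1 / 2) (X ^ j)) / 4)) (m : ℕ) :
    (∀ s ≤ m, Summable fun k : DecTuple s => (∏ i, w (k.1 i)) *
      (∏ i, ∏ j ∈ Finset.Ioi i, ((k.1 i : ℝ) ^ 2 - (k.1 j : ℝ) ^ 2) ^ 2) *
        correlation (momentFunctional ε) m s (fun i => -(k.1 i : ℝ) ^ 2)) ∧
    squareSeries q ^ (4 * (m * (m + ε))) =
      ∑ s ∈ Finset.range (m + 1), 4 ^ s * ∑' k : DecTuple s, (∏ i, w (k.1 i)) *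
        (∏ i, ∏ j ∈ Finset.Ioi i, ((k.1 i : ℝ) ^ 2 - (k.1 j : ℝ) ^ 2) ^ 2) *
        correlation (momentFunctional ε) m s (fun i => -(k.1 i : ℝ) ^ 2) := by
  have hμ := momentFunctional_eq_odeFunctional hε
  obtain ⟨hne, hdet⟩ := det_hankelMatrix_odeFunctional_div hμ (by norm_num)
    (lambertSlope (-q)) β m
  obtain ⟨h1, h2⟩ := correlation_expansion (w := w) (c := 4) (m := m) hμ hne
    (L := (1 / 4 : ℝ) • (odeFunctional ε (lambertSlope (-q)) β -
      odeFunctional ε (1 / 2) (-1 / 2))) hw neg_natCast_sq_injective (fun j =>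
        (hsum j).congr_of_eq (fun _ => rfl) (by simp; ring))
  have hl : odeFunctional ε (1 / 2) (-1 / 2) + (4 : ℝ) • (1 / 4 : ℝ) •
      (odeFunctional ε (lambertSlope (-q)) β - odeFunctional ε (1 / 2) (-1 / 2)) =
      odeFunctional ε (lambertSlope (-q)) β := by
    rw [smul_smul]; norm_num
  have hsub : ∀ x y : ℝ, (-y - -x) ^ 2 = (x - y) ^ 2 := fun x y => by ring
  simp only [hsub] at h1 h2
  refine ⟨h1, ?_⟩
  rw [h2, hl, hdet, lambertSlope_neg hq0 hq1, pow_mul]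
  congr 1
  ring

theorem corollary4p3 (q : ℝ) (hq0 : 0 < q) (hq1 : q < 1) (m : ℕ) :
    ((∀ s ≤ m, Summable fun k : DecTuple s =>
        (∏ i, q ^ k.1 i * (k.1 i : ℝ) / (1 + (-q) ^ k.1 i)) *
          (∏ i, ∏ j ∈ Finset.Ioi i, ((k.1 i : ℝ) ^ 2 - (k.1 j : ℝ) ^ 2) ^ 2) *
          correlation (momentFunctional 0) m s (fun i => -(k.1 i : ℝ) ^ 2)) ∧
      squareSeries q ^ (4 * m ^ 2) =
        ∑ s ∈ Finset.range (m + 1), 4 ^ s * ∑' k : DecTuple s,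
          (∏ i, q ^ k.1 i * (k.1 i : ℝ) / (1 + (-q) ^ k.1 i)) *
            (∏ i, ∏ j ∈ Finset.Ioi i, ((k.1 i : ℝ) ^ 2 - (k.1 j : ℝ) ^ 2) ^ 2) *
            correlation (momentFunctional 0) m s (fun i => -(k.1 i : ℝ) ^ 2)) ∧
    ((∀ s ≤ m, Summable fun k : DecTuple s =>
        (∏ i, q ^ k.1 i * (k.1 i : ℝ) ^ 3 / (1 - (-q) ^ k.1 i)) *
          (∏ i, ∏ j ∈ Finset.Ioi i, ((k.1 i : ℝ) ^ 2 - (k.1 j : ℝ) ^ 2) ^ 2) *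
          correlation (momentFunctional 1) m s (fun i => -(k.1 i : ℝ) ^ 2)) ∧
      squareSeries q ^ (4 * m * (m + 1)) =
        ∑ s ∈ Finset.range (m + 1), 4 ^ s * ∑' k : DecTuple s,
          (∏ i, q ^ k.1 i * (k.1 i : ℝ) ^ 3 / (1 - (-q) ^ k.1 i)) *
            (∏ i, ∏ j ∈ Finset.Ioi i, ((k.1 i : ℝ) ^ 2 - (k.1 j : ℝ) ^ 2) ^ 2) *
            correlation (momentFunctional 1) m s (fun i => -(k.1 i : ℝ) ^ 2)) := by
  have hn0 : -q ≠ 0 := by simpa using hq0.ne'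
  have habs : |(-q)| < 1 := by rwa [abs_neg, abs_of_pos hq0]
  obtain ⟨β, hode⟩ := exists_isOdeSolution_lambertL hn0 habs
  obtain ⟨h1, h2⟩ := squareSeries_expansion hq0 hq1 (ε := 0) (by norm_num) (by simp)
    (hasSum_weight_zero hq0 hq1 hode) m
  obtain ⟨h3, h4⟩ := squareSeries_expansion hq0 hq1 (ε := 1) le_rfl (by simp)
    (hasSum_weight_one hq0 hq1 hode) m
  rw [add_zero, ← sq] at h2
  rw [← mul_assoc] at h4
  exact ⟨⟨h1, h2⟩, h3, h4⟩
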